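/- **Setting.** Consider the complete directed graph on a source $p_0$ and peers $p_1,\dots,p_k$, with upload capacities $C_0,\dots,C_k\ge 0$, and a data stream with $n$ layers $x_1,\dots,x_n$ of rates $L_1,\dots,L_n\ge 0$ (all real). The demand sets are nested, $\{p_0\}=X_{n+1}\subseteq X_n\subseteq\dots\subseteq X_1=\{p_0,\dots,p_k\}$, where the peers in $X_j$ are those that demand $x_j$; every $X_j$ with $j\le n$ contains at least one peer. Write $|X_j|$ for the number of *peers* in $X_j$ (the source is not counted). A *scheme* consists of a finite number of rounds and of random variables on a finite probability space: independent layers $x_1,\dots,x_n$ and, for every round $t$ and ordered pair of nodes, the symbol sent from $p_i$ to $p_j$ in round $t$. Let $p_i\to p_j$ denote the tuple of all symbols sent from $p_i$ to $p_j$. The vector $(L_1,\dots,L_n)$ is *achievable* if there is a scheme such that (with $H$ and $I$ Shannon entropy and mutual information, in any fixed unit) - $H(p_0\to p_i\mid x_1,\dots,x_n)=0$ for all $i$; - each symbol sent by a peer in round $t$ has conditional entropy $0$ given everything that this peer received in rounds before $t$; - $H(p_i\to p_i)=0$ and $\sum_j H(p_i\to p_j)\le C_i$ for all $i$; - for every layer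 $j$ we have $H(x_j)=L_j$, and every peer $p_i\in X_j$ satisfies $I\big((p_l\to p_i)_{0\le l\le k};x_j\big)=H(x_j)$. It is *achievable by routing* if, in addition, the scheme can be chosen such that all layers are split into finitely many packets, the packets of all layers together being mutually independent, every transmitted symbol is a collection of packets, and a peer sends only packets that it received in an earlier round. The *margins* are $$N_j=\sum_{i=j}^n|X_i|L_i+\sum_{i=1}^{j-1}L_i-\sum_{p_i\in X_j}C_i\quad(1\le j\le n),\qquad N_{n+1}=0,$$ where the last sum includes $C_0$. The *dominant subsequence* $N_{d_1},\dots,N_{d_{h+1}}$ of $N_1,\dots,N_{n+1}$ is given by $d_{h+1}=n+1$ and, going backwards, $d_i$ is the greatest index such that $d_i<d_{i+1}$ and $N_{d_i}>N_{d_{i+1}}$; it is continued until no such index exists. **Statement.** The vector $(L_1,\dots,L_n)$ is achievable if and only if $$C_0\ge\sum_{i=1}^nL_i\qquad\text{and}\qquad\sum_{i=0}^kC_i\ge\sum_{i=1}^n|X_i|L_i+\sum_{i=1}^h\frac{N_{d_i}-N_{d_{i+1}}}{|X_{d_i}|-1}.$$ (When the first inequality holds, $|X_{d_i}|\ge2$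 for all $i\le h$, so that the second one makes sense.) Moreover, $(L_1,\dots,L_n)$ is achievable by routing under exactly the same condition, so coding gives no capacity advantage over routing. -/

import Mathlib

open scoped BigOperators

namespace P2P

/-! ### Shannon information on a finite probability space -/

/-- The probability of the event `A` under the weight function `P`. -/
noncomputable def prob {Ω : Type} [Fintype Ω] (P : Ω → ℝ) (A : Ω → Prop) : ℝ :=
  open Classical in ∑ ω ∈ Finset.univ.filter A, P ω

/-- Shannon entropy `H(X) = ∑ₐ -P(X = a) log P(X = a)`.  The base of the logarithm only fixes the
unit in which rates and capacities are measured. -/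
noncomputable def entropy {Ω α : Type} [Fintype Ω] (P : Ω → ℝ) (X : Ω → α) : ℝ :=
  open Classical in ∑ a ∈ Finset.univ.image X, Real.negMulLog (prob P (fun ω => X ω = a))

/-- Conditional entropy `H(X | Y) = H(X, Y) - H(Y)`. -/
noncomputable def condEntropy {Ω α β : Type} [Fintype Ω] (P : Ω → ℝ)
    (X : Ω → α) (Y : Ω → β) : ℝ :=
  entropy P (fun ω => (X ω, Y ω)) - entropy P Y

/-- Mutual information `I(X; Y) = H(X) + H(Y) - H(X, Y)`. -/
noncomputable def mutualInfo {Ω α β : Type} [Fintype Ω] (P : Ω → ℝ)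
    (X : Ω → α) (Y : Ω → β) : ℝ :=
  entropy P X + entropy P Y - entropy P (fun ω => (X ω, Y ω))

/-- Mutual independence of a finite family of random variables. -/
def Independent {Ω ι α : Type} [Fintype Ω] [Fintype ι] (P : Ω → ℝ) (X : ι → Ω → α) : Prop :=
  ∀ a : ι → α, prob P (fun ω => ∀ i, X i ω = a i) = ∏ i, prob P (fun ω => X i ω = a i)

/-- Two random variables carry the same information: each is a function of the other. -/
def SameInfo {Ω α β : Type} (X : Ω → α) (Y : Ω → β) : Prop :=
  ∀ ω ω' : Ω, X ω = X ω' ↔ Y ω = Y ω'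

/-! ### Coding and routing schemes -/

/-- The random objects of a transmission over `T` rounds in the complete directed graph on the nodes
`p_0, …, p_k`, where node `0` is the source: the layers `x j` of the data stream, and the symbol
`msg t u v` sent in round `t` from `p_u` to `p_v`.  All are random variables on one finite
probability space `(Ω, P)`. -/
structure Scheme (k n : ℕ) where
  Ω : Type
  [fintypeΩ : Fintype Ω]
  P : Ω → ℝ
  P_nonneg : ∀ ω, 0 ≤ P ω
  P_sum : ∑ ω, P ω = 1
  Data : Type
  Msg : Type
  T : ℕ
  x : Fin n → Ω → Data
  msg : Fin T → Fin (k + 1) → Fin (k + 1) → Ω → Msg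

attribute [instance] Scheme.fintypeΩ

namespace Scheme

variable {k n : ℕ} (S : Scheme k n)

/-- Everything sent on the link `p_u → p_v`, over all rounds. -/
def link (u v : Fin (k + 1)) : S.Ω → (Fin S.T → S.Msg) :=
  fun ω t => S.msg t u v ω

/-- Everything received by `p_v`, over all rounds. -/
def inbox (v : Fin (k + 1)) : S.Ω → (Fin (k + 1) → Fin S.T → S.Msg) :=
  fun ω u => S.link u v ω

/-- Everything received by `p_v` strictly before round `t`. -/
def inboxBefore (t : Fin S.T) (v : Fin (k + 1)) :
    S.Ω → (Fin (k + 1) → {s : Fin S.T // s < t} → S.Msg) :=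
  fun ω u s => S.msg s.1 u v ω

/-- The scheme delivers independent layers of rates `L`, with demand sets `X` and upload
capacities `C`. -/
structure Delivers (X : Fin (n + 1) → Finset (Fin (k + 1))) (C : Fin (k + 1) → ℝ)
    (L : Fin n → ℝ) : Prop where
  /-- the layers are independent -/
  indep : Independent S.P S.x
  /-- layer `j` has rate `L j` -/
  rate : ∀ j, entropy S.P (S.x j) = L j
  /-- the outgoing links of the source are functions of the layers -/
  source : ∀ v, condEntropy S.P (S.link 0 v) (fun ω j => S.x j ω) = 0
  /-- what a peer sends is a function of what it has received before -/
  causal : ∀ t u v, u ≠ 0 → condEntropy S.P (S.msg t u v) (S.inboxBefore t u) = 0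
  /-- nothing is sent on loops -/
  no_loop : ∀ u, entropy S.P (S.link u u) = 0
  /-- upload capacities -/
  capacity : ∀ u, ∑ v, entropy S.P (S.link u v) ≤ C u
  /-- every peer recovers the layers that it demands -/
  decode : ∀ j : Fin n, ∀ i ∈ X j.castSucc, i ≠ 0 →
    mutualInfo S.P (S.inbox i) (S.x j) = entropy S.P (S.x j)

/-- The scheme only replicates and forwards: every layer is split into independent packets `z q`,
every transmitted symbol is a collection `send t u v` of packets, and a peer sends only packets
which it has received in an earlier round. -/
def IsRouting : Prop :=
  ∃ (Q Pkt : Type) (_ : Fintype Q) (layer : Q → Fin n) (z : Q → S.Ω → Pkt)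
    (send : Fin S.T → Fin (k + 1) → Fin (k + 1) → Set Q),
    Independent S.P z ∧
    (∀ j, SameInfo (S.x j) (fun ω (q : {q : Q // layer q = j}) => z q.1 ω)) ∧
    (∀ t u v, SameInfo (S.msg t u v) (fun ω (q : {q : Q // q ∈ send t u v}) => z q.1 ω)) ∧
    (∀ t u v, u ≠ 0 → ∀ q ∈ send t u v, ∃ s < t, ∃ w, q ∈ send s w u)

end Scheme

/-- `L` is achievable by arbitrary coding. -/
def Achievable {k n : ℕ} (X : Fin (n + 1) → Finset (Fin (k + 1))) (C : Fin (k + 1) → ℝ)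
    (L : Fin n → ℝ) : Prop :=
  ∃ S : Scheme k n, S.Delivers X C L

/-- `L` is achievable by routing. -/
def AchievableByRouting {k n : ℕ} (X : Fin (n + 1) → Finset (Fin (k + 1)))
    (C : Fin (k + 1) → ℝ) (L : Fin n → ℝ) : Prop :=
  ∃ S : Scheme k n, S.Delivers X C L ∧ S.IsRouting

/-! ### The capacity region -/

/-- The number of peers (the source `p_0` is not counted) in `A`. -/
def peerCount {k : ℕ} (A : Finset (Fin (k + 1))) : ℕ := (A.erase 0).card

/-- The margins `N_1, …, N_n, N_{n+1}`:
`N_j = ∑_{i ≥ j} |X_i| L_i + ∑_{i < j} L_i - ∑_{p_i ∈ X_j} C_i` and `N_{n+1} = 0`. -/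
def margin {k n : ℕ} (X : Fin (n + 1) → Finset (Fin (k + 1))) (C : Fin (k + 1) → ℝ)
    (L : Fin n → ℝ) : Fin (n + 1) → ℝ :=
  Fin.snoc (α := fun _ => ℝ)
    (fun j : Fin n => ∑ i ∈ Finset.Ici j, (peerCount (X i.castSucc) : ℝ) * L i
      + ∑ i ∈ Finset.Iio j, L i - ∑ p ∈ X j.castSucc, C p) 0

/-- `a (d 0), …, a (d h)` is the dominant subsequence of `a`: it ends with the last term, each index
is the greatest one before the next index with a larger term, and it cannot be continued to the
left. -/
structure IsDominantSubsequence {n h : ℕ} (a : Fin (n + 1) → ℝ) (d : Fin (h + 1) → Fin (n + 1)) :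
    Prop where
  last : d (Fin.last h) = Fin.last n
  step : ∀ j : Fin h,
    IsGreatest {i | i < d j.succ ∧ a (d j.succ) < a i} (d j.castSucc)
  first : ¬ ∃ i, i < d 0 ∧ a (d 0) < a i

/-- Every finite nonempty sequence has a dominant subsequence. -/
theorem exists_isDominantSubsequence {n : ℕ} (a : Fin (n + 1) → ℝ) :
    ∃ (h : ℕ) (d : Fin (h + 1) → Fin (n + 1)), IsDominantSubsequence a d := by
  have key : ∀ m : ℕ, ∀ e : Fin (n + 1), (e : ℕ) = m →
      ∃ (h : ℕ) (d : Fin (h + 1) → Fin (n + 1)), d (Fin.last h) = e ∧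
        (∀ j : Fin h, IsGreatest {i | i < d j.succ ∧ a (d j.succ) < a i} (d j.castSucc)) ∧
        ¬ ∃ i, i < d 0 ∧ a (d 0) < a i := by
    intro m
    induction m using Nat.strong_induction_on with
    | _ m ih =>
      intro e he
      by_cases hex : ∃ i, i < e ∧ a e < a i
      · have hfin : ({i | i < e ∧ a e < a i} : Set (Fin (n + 1))).Finite := Set.toFinite _
        obtain ⟨g, hg⟩ := hfin.exists_maximal hex
        have hgr : IsGreatest {i | i < e ∧ a e < a i} g :=
          ⟨hg.1, fun i hi => (le_total i g).elim id (fun hle => hg.2 hi hle)⟩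
        obtain ⟨h, d, h1, h2, h3⟩ := ih g (he ▸ hg.1.1) g rfl
        refine ⟨h + 1, Fin.snoc (α := fun _ => Fin (n + 1)) d e, by simp, ?_, ?_⟩
        · intro j
          induction j using Fin.lastCases with
          | last =>
            rw [Fin.succ_last, Fin.snoc_last, Fin.snoc_castSucc, h1]
            exact hgr
          | cast j =>
            rw [Fin.succ_castSucc, Fin.snoc_castSucc, Fin.snoc_castSucc]
            exact h2 j
        · rw [← Fin.castSucc_zero, Fin.snoc_castSucc]
          exact h3
      · exact ⟨0, fun _ => e, rfl, fun j => j.elim0, hex⟩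
  obtain ⟨h, d, h1, h2, h3⟩ := key _ (Fin.last n) rfl
  exact ⟨h, d, h1, h2, h3⟩

/-- The two inequalities `C_0 ≥ ∑ L_i` and
`∑_{p_i ∈ X_1} C_i ≥ ∑ |X_i| L_i + ∑_{i=1}^h (N_{d_i} - N_{d_{i+1}}) / (|X_{d_i}| - 1)`. -/
def InRegion {k n h : ℕ} (X : Fin (n + 1) → Finset (Fin (k + 1))) (C : Fin (k + 1) → ℝ)
    (L : Fin n → ℝ) (d : Fin (h + 1) → Fin (n + 1)) : Prop :=
  ∑ j, L j ≤ C 0 ∧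
  ∑ j : Fin n, (peerCount (X j.castSucc) : ℝ) * L j
    + ∑ i : Fin h, (margin X C L (d i.castSucc) - margin X C L (d i.succ))
        / ((peerCount (X (d i.castSucc)) : ℝ) - 1)
    ≤ ∑ p ∈ X 0, C p

end P2P

/-! Put `μ i = |X_i| - 1` and let `M j` be the maximum of `N_i` over `i ≥ j`. The dominant
subsequence lists the places where `M` drops, so the sum in the second inequality is `∑ (M j - M
(j+1)) / μ j` (`sum_eq_sum_tailMax`).

Converse. Only monotonicity and submodularity of joint entropy, independence of the layers,
causality and decoding are needed. Let `g i` be the information about `x_i`, given the earlier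
layers, received by peers outside `X_i`: the help that layer `i` gets from peers that do not want
it. This reception comes on top of the demanded data, so `∑ |X_i| L_i + ∑ g i ≤ ∑ C_i`
(`sum_add_sum_layerInfo_le`). On the other hand a deficit of the nodes in `X_j` can be covered only
by such help: `N_j ≤ ∑_{i ≥ j} μ i * g i` (`margin_le`). As `μ` is antitone, these constraints force
`∑ g i` to be at least `∑ (M j - M (j+1)) / μ j` (`sum_tail_div_le_sum`).

Direct part. Split layer `j` into packets `(j, v)`; the source sends each to its relay `v`, which
forwards it to the other peers demanding `j`. A relay in `X_j` makes `μ j` copies, one outside makes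
`μ j + 1`. Once the source has reserved `∑ L_i`, it too needs only `μ j` further copies. Of the load
`μ j * L j`, the amount `M j - M (j+1)` is assigned without regard to membership, at cost inflated
by `1 + 1 / μ j`; the rest fits inside the sets `X_j`. The total surcharge is exactly the sum in the
second inequality (`exists_rates`). This scheme is a routing scheme, so coding gains nothing. -/

namespace P2P

open Finset

/-! ### Entropy on a finite probability space and its submodularity -/

section Entropy

variable {Ω α β γ ι : Type} [Fintype Ω] {P : Ω → ℝ}

/-- The probability of the value that `X` takes at `ω`. -/
noncomputable def valueProb (P : Ω → ℝ) (X : Ω → α) (ω : Ω) : ℝ :=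
  prob P (fun ω' => X ω' = X ω)

theorem prob_mono (hP : ∀ ω, 0 ≤ P ω) {A B : Ω → Prop} (h : ∀ ω, A ω → B ω) :
    prob P A ≤ prob P B := by
  classical
  unfold prob
  refine Finset.sum_le_sum_of_subset_of_nonneg ?_ (fun ω _ _ => hP ω)
  intro ω hω
  simp only [Finset.mem_filter, Finset.mem_univ, true_and] at hω ⊢
  exact h ω hω

theorem prob_nonneg (hP : ∀ ω, 0 ≤ P ω) (A : Ω → Prop) : 0 ≤ prob P A :=
  Finset.sum_nonneg fun ω _ => hP ω

theorem prob_congr {A B : Ω → Prop} (h : ∀ ω, A ω ↔ B ω) : prob P A = prob P B := by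
  rw [show A = B from funext fun ω => propext (h ω)]

theorem le_valueProb (hP : ∀ ω, 0 ≤ P ω) (X : Ω → α) (ω : Ω) : P ω ≤ valueProb P X ω := by
  classical
  unfold valueProb prob
  exact Finset.single_le_sum (f := P) (fun ω _ => hP ω) (by simp)

/-- Entropy becomes an expectation over sample points, so variables with different value types can
be compared pointwise. -/
theorem entropy_eq_sum (X : Ω → α) :
    entropy P X = ∑ ω, P ω * -Real.log (valueProb P X ω) := by
  classical
  unfold entropy
  rw [← Finset.sum_fiberwise_of_maps_to (s := Finset.univ) (t := Finset.univ.image X) (g := X)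
    (fun ω _ => Finset.mem_image_of_mem X (Finset.mem_univ ω))]
  refine Finset.sum_congr (by congr!) fun a _ => ?_
  have : ∀ ω ∈ Finset.univ.filter (fun ω => X ω = a), P ω * -Real.log (valueProb P X ω)
      = P ω * -Real.log (prob P (fun ω' => X ω' = a)) := by
    intro ω hω
    simp only [Finset.mem_filter, Finset.mem_univ, true_and] at hω
    rw [valueProb, hω]
  rw [Finset.sum_congr rfl this, ← Finset.sum_mul, Real.negMulLog, neg_mul, mul_neg]
  congr 2

theorem valueProb_congr {X : Ω → α} {Y : Ω → β} (h : SameInfo X Y) :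
    valueProb P X = valueProb P Y := by
  funext ω
  exact prob_congr fun ω' => h ω' ω

theorem entropy_congr {X : Ω → α} {Y : Ω → β} (h : SameInfo X Y) :
    entropy P X = entropy P Y := by
  rw [entropy_eq_sum, entropy_eq_sum, valueProb_congr h]

theorem entropy_mono (hP : ∀ ω, 0 ≤ P ω) {X : Ω → α} {Y : Ω → β}
    (h : ∀ ω ω', X ω = X ω' → Y ω = Y ω') : entropy P Y ≤ entropy P X := by
  rw [entropy_eq_sum, entropy_eq_sum]
  refine Finset.sum_le_sum fun ω _ => ?_
  rcases (hP ω).eq_or_lt with h0 | h0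
  · simp [← h0]
  · refine mul_le_mul_of_nonneg_left (neg_le_neg ?_) h0.le
    exact Real.log_le_log (h0.trans_le (le_valueProb hP X ω)) (prob_mono hP fun ω' => h ω' ω)

theorem entropy_of_subsingleton (h1 : ∑ ω, P ω = 1) {X : Ω → α} (h : ∀ ω ω', X ω = X ω') :
    entropy P X = 0 := by
  rw [entropy_eq_sum]
  refine Finset.sum_eq_zero fun ω _ => ?_
  have : valueProb P X ω = 1 := by
    classical
    unfold valueProb prob
    rw [Finset.filter_true_of_mem fun ω' _ => h ω' ω, h1]
  simp [this]

open Classical in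
theorem prob_eq_sum_ite (A : Ω → Prop) : prob P A = ∑ ω, if A ω then P ω else 0 := by
  unfold prob
  rw [Finset.sum_filter]

/-- The estimate behind submodularity: the expectation of
`p(x, z) p(y, z) / (p(x, y, z) p(z))` is at most one. -/
theorem sum_ratio_le_one (hP : ∀ ω, 0 ≤ P ω) (h1 : ∑ ω, P ω = 1) (X : Ω → α) (Y : Ω → β)
    (Z : Ω → γ) :
    ∑ ω, P ω * (valueProb P (fun ω => (X ω, Z ω)) ω * valueProb P (fun ω => (Y ω, Z ω)) ω
      / (valueProb P (fun ω => (X ω, Y ω, Z ω)) ω * valueProb P Z ω)) ≤ 1 := by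
  classical
  set pA := valueProb P (fun ω => (X ω, Y ω, Z ω)) with hpA
  set pZ := valueProb P Z with hpZ
  have hZ0 : ∀ ω, 0 ≤ pZ ω := fun ω => prob_nonneg hP _
  have hA0 : ∀ ω, 0 ≤ pA ω := fun ω => prob_nonneg hP _
  -- Writing both numerators as sums over sample points `a`, `b` allows the sum over `ω` to be taken
  -- first; it cancels `p(x, y, z)` and leaves at most `1 / p(z)`.
  have expand : ∀ ω, P ω * (valueProb P (fun ω => (X ω, Z ω)) ω
      * valueProb P (fun ω => (Y ω, Z ω)) ω / (pA ω * pZ ω))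
      = ∑ a, ∑ b, P a * P b * (if (X a, Z a) = (X ω, Z ω) ∧ (Y b, Z b) = (Y ω, Z ω) then
        P ω / (pA ω * pZ ω) else 0) := by
    intro ω
    rw [valueProb, valueProb, prob_eq_sum_ite, prob_eq_sum_ite, Finset.sum_mul_sum, mul_div_assoc',
      Finset.mul_sum, Finset.sum_div]
    refine Finset.sum_congr rfl fun a _ => ?_
    rw [Finset.mul_sum, Finset.sum_div]
    refine Finset.sum_congr rfl fun b _ => ?_
    by_cases h1 : (X a, Z a) = (X ω, Z ω) <;> by_cases h2 : (Y b, Z b) = (Y ω, Z ω) <;>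
      simp only [h1, h2, if_true, if_false, and_true, and_false, mul_zero, zero_mul, zero_div]
    ring
  have inner : ∀ a b, ∑ ω, (if (X a, Z a) = (X ω, Z ω) ∧ (Y b, Z b) = (Y ω, Z ω) then
        P ω / (pA ω * pZ ω) else 0) ≤ if Z b = Z a then 1 / pZ a else 0 := by
    intro a b
    by_cases hex : ∃ c, (X a, Z a) = (X c, Z c) ∧ (Y b, Z b) = (Y c, Z c)
    · obtain ⟨c, hc1, hc2⟩ := hex
      simp only [Prod.mk.injEq] at hc1 hc2
      rw [if_pos (hc2.2.trans hc1.2.symm)]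
      have e : ∀ ω, (if (X a, Z a) = (X ω, Z ω) ∧ (Y b, Z b) = (Y ω, Z ω) then
          P ω / (pA ω * pZ ω) else 0)
          = (if (X ω, Y ω, Z ω) = (X c, Y c, Z c) then P ω else 0) / (pA c * pZ a) := by
        intro ω
        by_cases h : (X ω, Y ω, Z ω) = (X c, Y c, Z c)
        · have hA : pA ω = pA c := by
            simp only [hpA, valueProb]
            rw [h]
          simp only [Prod.mk.injEq] at h
          have hZ : pZ ω = pZ a := by
            simp only [hpZ, valueProb]
            rw [h.2.2, hc1.2]
          rw [if_pos, if_pos, hA, hZ]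
          · simp [h]
          · simp [h, hc1, hc2]
        · rw [if_neg, if_neg h, zero_div]
          contrapose! h
          simp only [Prod.mk.injEq] at h ⊢
          exact ⟨h.1.1.symm.trans hc1.1, h.2.1.symm.trans hc2.1, h.1.2.symm.trans hc1.2⟩
      rw [Finset.sum_congr rfl fun ω _ => e ω, ← Finset.sum_div]
      have hc : pA c = ∑ ω, if (X ω, Y ω, Z ω) = (X c, Y c, Z c) then P ω else 0 := by
        rw [hpA, valueProb, prob_eq_sum_ite]
        congr!
      rw [← hc]
      rcases (hA0 c).eq_or_lt with h0 | h0
      · rw [← h0, zero_div]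
        exact div_nonneg zero_le_one (hZ0 a)
      · rw [div_mul_eq_div_div, div_self h0.ne']
    · rw [Finset.sum_eq_zero]
      · split_ifs
        · exact div_nonneg zero_le_one (hZ0 a)
        · exact le_rfl
      · intro ω _
        rw [if_neg]
        exact fun h => hex ⟨ω, h⟩
  rw [Finset.sum_congr rfl fun ω _ => expand ω, Finset.sum_comm]
  calc ∑ a, ∑ ω, ∑ b, P a * P b * (if (X a, Z a) = (X ω, Z ω) ∧ (Y b, Z b) = (Y ω, Z ω) then
        P ω / (pA ω * pZ ω) else 0)
      = ∑ a, ∑ b, P a * P b * ∑ ω, (if (X a, Z a) = (X ω, Z ω) ∧ (Y b, Z b) = (Y ω, Z ω) then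
        P ω / (pA ω * pZ ω) else 0) := by
        refine Finset.sum_congr rfl fun a _ => ?_
        rw [Finset.sum_comm]
        exact Finset.sum_congr rfl fun b _ => (Finset.mul_sum _ _ _).symm
    _ ≤ ∑ a, ∑ b, P a * P b * (if Z b = Z a then 1 / pZ a else 0) :=
        Finset.sum_le_sum fun a _ => Finset.sum_le_sum fun b _ =>
          mul_le_mul_of_nonneg_left (inner a b) (mul_nonneg (hP a) (hP b))
    _ = ∑ a, P a * (pZ a / pZ a) := by
        refine Finset.sum_congr rfl fun a _ => ?_
        have : pZ a = ∑ b, if Z b = Z a then P b else 0 := prob_eq_sum_ite _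
        rw [this, Finset.sum_div, Finset.mul_sum, ← this]
        refine Finset.sum_congr rfl fun b _ => ?_
        split_ifs <;> ring
    _ ≤ ∑ a, P a := Finset.sum_le_sum fun a _ =>
        mul_le_of_le_one_right (hP a) (div_self_le_one _)
    _ = 1 := h1

/-- Apply `log t ≤ t - 1` to the ratio in `sum_ratio_le_one`; sample points of weight zero
contribute nothing. -/
theorem entropy_submodular (hP : ∀ ω, 0 ≤ P ω) (h1 : ∑ ω, P ω = 1) (X : Ω → α) (Y : Ω → β)
    (Z : Ω → γ) :
    entropy P (fun ω => (X ω, Y ω, Z ω)) + entropy P Z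
      ≤ entropy P (fun ω => (X ω, Z ω)) + entropy P (fun ω => (Y ω, Z ω)) := by
  have key := sum_ratio_le_one hP h1 X Y Z
  simp only [entropy_eq_sum]
  rw [← Finset.sum_add_distrib, ← Finset.sum_add_distrib, ← sub_nonneg, ← Finset.sum_sub_distrib]
  rw [← sub_nonneg, ← h1, ← Finset.sum_sub_distrib] at key
  refine key.trans (Finset.sum_le_sum fun ω _ => ?_)
  rcases (hP ω).eq_or_lt with h0 | h0
  · simp [← h0]
  · have ha := h0.trans_le (le_valueProb hP (fun ω => (X ω, Y ω, Z ω)) ω)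
    have hb := h0.trans_le (le_valueProb hP (fun ω => (X ω, Z ω)) ω)
    have hc := h0.trans_le (le_valueProb hP (fun ω => (Y ω, Z ω)) ω)
    have hd := h0.trans_le (le_valueProb hP Z ω)
    have hlog := Real.log_le_sub_one_of_pos (div_pos (mul_pos hb hc) (mul_pos ha hd))
    rw [Real.log_div (mul_pos hb hc).ne' (mul_pos ha hd).ne', Real.log_mul hb.ne' hc.ne',
      Real.log_mul ha.ne' hd.ne'] at hlog
    have := mul_le_mul_of_nonneg_left hlog h0.le
    linarith

theorem entropy_of_independent (hP : ∀ ω, 0 ≤ P ω) [Fintype ι] {X : ι → Ω → α}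
    (h : Independent P X) : entropy P (fun ω i => X i ω) = ∑ i, entropy P (X i) := by
  simp only [entropy_eq_sum]
  rw [Finset.sum_comm]
  refine Finset.sum_congr rfl fun ω _ => ?_
  rcases (hP ω).eq_or_lt with h0 | h0
  · simp [← h0]
  · rw [← Finset.mul_sum, Finset.sum_neg_distrib, ← Real.log_prod
      (fun i _ => (h0.trans_le (le_valueProb hP (X i) ω)).ne')]
    congr 3
    rw [valueProb, prob_congr (B := fun ω' => ∀ i, X i ω' = X i ω) fun ω' => funext_iff]
    exact h fun i => X i ω

end Entropy

/-! ### Joint entropy as a polymatroid -/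

section Joint

variable {Ω α ι : Type} [Fintype Ω] {P : Ω → ℝ}

/-- The joint entropy of the subfamily of `Y` indexed by `A`. -/
noncomputable def jointEntropy (P : Ω → ℝ) (Y : ι → Ω → α) (A : Set ι) : ℝ :=
  entropy P (fun ω (i : A) => Y i ω)

theorem entropy_eq_jointEntropy {β : Type} {Y : ι → Ω → α} {A : Set ι} {X : Ω → β}
    (h : ∀ ω ω', X ω = X ω' ↔ ∀ i ∈ A, Y i ω = Y i ω') :
    entropy P X = jointEntropy P Y A :=
  entropy_congr fun ω ω' => by simp [h, funext_iff]

/-- A monotone submodular set function with value zero at the empty set. -/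
structure IsPolymatroid (H : Set ι → ℝ) : Prop where
  empty : H ∅ = 0
  mono : ∀ {A B : Set ι}, A ⊆ B → H A ≤ H B
  submod : ∀ A B : Set ι, H (A ∪ B) + H (A ∩ B) ≤ H A + H B

theorem isPolymatroid_jointEntropy (hP : ∀ ω, 0 ≤ P ω) (h1 : ∑ ω, P ω = 1) (Y : ι → Ω → α) :
    IsPolymatroid (jointEntropy P Y) where
  empty := entropy_of_subsingleton h1 fun ω ω' => funext fun i => i.2.elim
  mono := fun {A B} hAB => entropy_mono hP fun ω ω' h =>
    funext fun i => congrFun h ⟨i.1, hAB i.2⟩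
  submod := fun A B => by
    have := entropy_submodular hP h1 (fun ω (i : A) => Y i ω) (fun ω (i : B) => Y i ω)
      (fun ω (i : (A ∩ B : Set ι)) => Y i ω)
    rw [entropy_eq_jointEntropy (Y := Y) (A := A ∪ B), entropy_eq_jointEntropy (Y := Y) (A := A ∩ B),
      entropy_eq_jointEntropy (Y := Y) (A := A), entropy_eq_jointEntropy (Y := Y) (A := B)] at this
    · exact this
    all_goals
      intro ω ω'
      simp only [Prod.mk.injEq, funext_iff, Subtype.forall, Set.mem_union, Set.mem_inter_iff]
      try grind

end Joint

namespace IsPolymatroid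

variable {ι κ : Type} {H : Set ι → ℝ}

theorem nonneg (hH : IsPolymatroid H) (A : Set ι) : 0 ≤ H A :=
  hH.empty ▸ hH.mono (Set.empty_subset A)

theorem union_le (hH : IsPolymatroid H) (A B : Set ι) : H (A ∪ B) ≤ H A + H B := by
  linarith [hH.submod A B, hH.nonneg (A ∩ B)]

theorem submod' (hH : IsPolymatroid H) {A B U D : Set ι} (hU : U ⊆ A ∪ B) (hDA : D ⊆ A)
    (hDB : D ⊆ B) : H U + H D ≤ H A + H B := by
  linarith [hH.submod A B, hH.mono hU, hH.mono (Set.subset_inter hDA hDB)]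

/-- Conditional subadditivity for a finite union. -/
theorem union_biUnion_le (hH : IsPolymatroid H) (A : κ → Set ι) (s : Finset κ) {D E : Set ι}
    (hED : E ⊆ D) : H (D ∪ ⋃ v ∈ s, A v) ≤ H D + ∑ v ∈ s, (H (A v ∪ E) - H E) := by
  classical
  induction s using Finset.induction_on with
  | empty => simp
  | insert a s ha ih =>
    rw [Finset.sum_insert ha]
    have := hH.submod' (A := A a ∪ E) (B := D ∪ ⋃ v ∈ s, A v) (U := D ∪ ⋃ v ∈ insert a s, A v)
      (D := E) (by
        intro x hx
        simp only [Set.mem_union, Set.mem_iUnion, Finset.mem_insert] at hx ⊢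
        grind) Set.subset_union_right (hED.trans Set.subset_union_left)
    linarith

theorem biUnion_le (hH : IsPolymatroid H) (A : κ → Set ι) (s : Finset κ) :
    H (⋃ v ∈ s, A v) ≤ ∑ v ∈ s, H (A v) := by
  simpa [hH.empty] using hH.union_biUnion_le A s (Set.Subset.refl ∅)

/-- The equation `H (insert i A) = H A` expresses that `i` is almost surely a function of `A`;
submodularity preserves it when `A` grows. -/
theorem determined_mono (hH : IsPolymatroid H) {A B : Set ι} (hAB : A ⊆ B) {i : ι}
    (h : H (insert i A) = H A) : H (insert i B) = H B := by
  refine le_antisymm ?_ (hH.mono (Set.subset_insert i B))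
  have := hH.submod' (A := insert i A) (B := B) (U := insert i B) (D := A)
    (by intro x; simp only [Set.mem_insert_iff, Set.mem_union]; tauto)
    (Set.subset_insert i A) hAB
  linarith

theorem determined_of_mem {B : Set ι} {i : ι} (h : i ∈ B) : H (insert i B) = H B := by
  rw [Set.insert_eq_of_mem h]

theorem union_eq_of_determined [Finite ι] (hH : IsPolymatroid H) {A B : Set ι}
    (h : ∀ i ∈ A, H (insert i B) = H B) : H (B ∪ A) = H B := by
  induction A, Set.toFinite A using Set.Finite.induction_on with
  | empty => simp
  | @insert a s _ _ ih =>
    rw [Set.union_insert, hH.determined_mono Set.subset_union_left (h a (Set.mem_insert a s))]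
    exact ih fun i hi => h i (Set.mem_insert_of_mem a hi)

/-- This transitivity lets causality and decoding be chained along the rounds. -/
theorem determined_trans [Finite ι] (hH : IsPolymatroid H) {A B : Set ι}
    (h : ∀ i ∈ A, H (insert i B) = H B) {j : ι} (hj : H (insert j A) = H A) :
    H (insert j B) = H B := by
  refine le_antisymm ?_ (hH.mono (Set.subset_insert j B))
  rw [← hH.union_eq_of_determined h,
    ← hH.determined_mono (Set.subset_union_right (s := B) (t := A)) hj]
  exact hH.mono (Set.insert_subset_insert Set.subset_union_left)

end IsPolymatroid

/-- Independence makes subadditivity tight on the whole family. Splitting the family into `S` and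
its complement then makes it tight on `S`. -/
theorem jointEntropy_of_independent {Ω ι α : Type} [Fintype Ω] [Fintype ι] {P : Ω → ℝ}
    (hP : ∀ ω, 0 ≤ P ω) (h1 : ∑ ω, P ω = 1) {Y : ι → Ω → α} (hY : Independent P Y)
    (S : Finset ι) : jointEntropy P Y S = ∑ i ∈ S, entropy P (Y i) := by
  classical
  have hpoly := isPolymatroid_jointEntropy hP h1 Y
  have hsing : ∀ i, jointEntropy P Y {i} = entropy P (Y i) := fun i =>
    (entropy_eq_jointEntropy (by simp)).symm
  have hle : ∀ S : Finset ι, jointEntropy P Y S ≤ ∑ i ∈ S, entropy P (Y i) := by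
    intro S
    have := hpoly.biUnion_le (fun i : ι => {i}) S
    simp only [hsing] at this
    exact le_trans (hpoly.mono fun i hi => by simpa using hi) this
  refine le_antisymm (hle S) ?_
  have hall : jointEntropy P Y Set.univ = ∑ i, entropy P (Y i) := by
    rw [← entropy_of_independent hP hY]
    exact (entropy_eq_jointEntropy fun ω ω' => by simp [funext_iff]).symm
  have h2 := hpoly.union_le (S : Set ι) ((Sᶜ : Finset ι) : Set ι)
  rw [Finset.coe_compl, Set.union_compl_self, hall, ← Finset.sum_add_sum_compl S,
    ← Finset.coe_compl] at h2
  linarith [hle Sᶜ]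

theorem sum_succ_sub_castSucc {n : ℕ} (f : Fin (n + 1) → ℝ) :
    ∑ i : Fin n, (f i.succ - f i.castSucc) = f (Fin.last n) - f 0 := by
  rw [Finset.sum_sub_distrib]
  linarith [Fin.sum_univ_succ f, Fin.sum_univ_castSucc f]

/-! ### Layers and transmitted symbols as one ground set; information about a layer -/

section Network

variable {k n T : ℕ}

/-- The indices of the random objects of a scheme: layers and transmitted symbols. -/
abbrev Obj (k n T : ℕ) : Type := Fin n ⊕ (Fin T × Fin (k + 1) × Fin (k + 1))

namespace Obj

/-- The symbols sent from `u` to `v`. -/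
def link (u v : Fin (k + 1)) : Set (Obj k n T) :=
  {a | ∃ t, a = Sum.inr (t, u, v)}

/-- The symbols received by `v`. -/
def inbox (v : Fin (k + 1)) : Set (Obj k n T) :=
  {a | ∃ t u, a = Sum.inr (t, u, v)}

/-- The symbols received by `v` before round `t`. -/
def inboxBefore (t : Fin T) (v : Fin (k + 1)) : Set (Obj k n T) :=
  {a | ∃ s < t, ∃ u, a = Sum.inr (s, u, v)}

/-- The layers that precede `i`. -/
def layersBefore (i : Fin (n + 1)) : Set (Obj k n T) :=
  {a | ∃ j : Fin n, j.castSucc < i ∧ a = Sum.inl j}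

/-- The symbols received by nodes outside of `A`. -/
def outside (A : Finset (Fin (k + 1))) : Set (Obj k n T) :=
  {a | ∃ t u v, v ∉ A ∧ a = Sum.inr (t, u, v)}

end Obj

/-- The properties of the joint entropies of a scheme on which the converse rests. -/
structure EntropyBounds (H : Set (Obj k n T) → ℝ) (X : Fin (n + 1) → Finset (Fin (k + 1)))
    (C : Fin (k + 1) → ℝ) (L : Fin n → ℝ) : Prop where
  poly : IsPolymatroid H
  layers : ∀ A : Finset (Fin n), H (Sum.inl '' (A : Set (Fin n))) = ∑ i ∈ A, L i
  causal : ∀ t u v, u ≠ 0 → H (insert (Sum.inr (t, u, v)) (Obj.inboxBefore t u))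
    = H (Obj.inboxBefore t u)
  capacity : ∀ u, ∑ v, H (Obj.link u v) ≤ C u
  decode : ∀ (j : Fin n), ∀ v ∈ X j.castSucc, v ≠ 0 →
    H (insert (Sum.inl j) (Obj.inbox v)) = H (Obj.inbox v)

/-- The information about layer `i` contained in `D`, given the preceding layers. -/
noncomputable def layerInfo (H : Set (Obj k n T) → ℝ) (L : Fin n → ℝ) (D : Set (Obj k n T))
    (i : Fin n) : ℝ :=
  L i - (H (D ∪ Obj.layersBefore i.succ) - H (D ∪ Obj.layersBefore i.castSucc))

namespace EntropyBounds

variable {H : Set (Obj k n T) → ℝ} {X : Fin (n + 1) → Finset (Fin (k + 1))}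
  {C : Fin (k + 1) → ℝ} {L : Fin n → ℝ}

theorem layersBefore_eq (i : Fin (n + 1)) : (Obj.layersBefore i : Set (Obj k n T))
    = Sum.inl '' (((Finset.univ.filter fun j : Fin n => j.castSucc < i) : Finset (Fin n)) :
      Set (Fin n)) := by
  ext a
  simp only [Obj.layersBefore, Set.mem_ofPred_eq, Set.mem_image, Finset.coe_filter,
    Finset.mem_univ, true_and]
  grind

theorem layersBefore_succ (i : Fin n) : (Obj.layersBefore i.succ : Set (Obj k n T))
    = insert (Sum.inl i) (Obj.layersBefore i.castSucc) := by
  ext a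
  simp only [Obj.layersBefore, Set.mem_ofPred_eq, Set.mem_insert_iff, Fin.castSucc_lt_succ_iff,
    Fin.castSucc_lt_castSucc_iff, le_iff_lt_or_eq]
  grind

theorem H_layersBefore (hB : EntropyBounds H X C L) (i : Fin (n + 1)) :
    H (Obj.layersBefore i) = ∑ j, if j.castSucc < i then L j else 0 := by
  rw [layersBefore_eq, hB.layers, Finset.sum_filter]

theorem H_layersBefore_last (hB : EntropyBounds H X C L) :
    H (Obj.layersBefore (Fin.last n)) = ∑ j, L j := by
  rw [hB.H_layersBefore]
  exact Finset.sum_congr rfl fun j _ => if_pos (Fin.castSucc_lt_last j)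

/-- By induction on the round, the links leaving the source determine every symbol, hence the inbox
of a peer that demands all layers. -/
theorem sum_le_source (hB : EntropyBounds H X C L) {v : Fin (k + 1)} (hv : v ≠ 0)
    (hvX : ∀ j : Fin n, v ∈ X j.castSucc) : ∑ j, L j ≤ C 0 := by
  set B : Set (Obj k n T) := ⋃ w ∈ (Finset.univ : Finset (Fin (k + 1))), Obj.link 0 w with hBdef
  have hmsg : ∀ m : ℕ, ∀ t : Fin T, (t : ℕ) = m → ∀ u w,
      H (insert (Sum.inr (t, u, w)) B) = H B := by
    intro m
    induction m using Nat.strong_induction_on with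
    | _ m ih =>
      intro t ht u w
      by_cases hu : u = 0
      · refine IsPolymatroid.determined_of_mem ?_
        simp only [hBdef, Set.mem_iUnion]
        exact ⟨w, Finset.mem_univ w, t, by rw [hu]⟩
      · refine hB.poly.determined_trans (A := Obj.inboxBefore t u) ?_ (hB.causal t u w hu)
        rintro _ ⟨s, hs, x, rfl⟩
        exact ih s (ht ▸ hs) s rfl x u
  have hlay : ∀ a ∈ (Obj.layersBefore (Fin.last n) : Set (Obj k n T)), H (insert a B) = H B := by
    rintro _ ⟨j, -, rfl⟩
    refine hB.poly.determined_trans (A := Obj.inbox v) ?_ (hB.decode j v (hvX j) hv)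
    rintro _ ⟨t, u, rfl⟩
    exact hmsg t t rfl u v
  calc ∑ j, L j = H (Obj.layersBefore (Fin.last n)) := hB.H_layersBefore_last.symm
    _ ≤ H (B ∪ Obj.layersBefore (Fin.last n)) := hB.poly.mono Set.subset_union_right
    _ = H B := hB.poly.union_eq_of_determined hlay
    _ ≤ ∑ w, H (Obj.link 0 w) := hB.poly.biUnion_le _ _
    _ ≤ C 0 := hB.capacity 0

theorem layerInfo_mono (hB : EntropyBounds H X C L) {D D' : Set (Obj k n T)} (h : D ⊆ D')
    (i : Fin n) : layerInfo H L D i ≤ layerInfo H L D' i := by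
  have := hB.poly.submod' (A := D ∪ Obj.layersBefore i.succ) (B := D' ∪ Obj.layersBefore i.castSucc)
    (U := D' ∪ Obj.layersBefore i.succ) (D := D ∪ Obj.layersBefore i.castSucc)
    (by intro x; simp only [Set.mem_union]; tauto)
    (Set.union_subset_union_right _ (by rw [layersBefore_succ]; exact Set.subset_insert _ _))
    (Set.union_subset_union_left _ h)
  unfold layerInfo
  linarith

/-- By monotonicity it suffices to take `D = ∅`, where independence of the layers gives zero. -/
theorem layerInfo_nonneg (hB : EntropyBounds H X C L) (D : Set (Obj k n T)) (i : Fin n) :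
    0 ≤ layerInfo H L D i := by
  refine le_trans (le_of_eq ?_) (hB.layerInfo_mono (Set.empty_subset D) i)
  have h1 : ∀ j : Fin n, (if j.castSucc < i.succ then L j else 0)
      = (if j = i then L i else 0) + if j.castSucc < i.castSucc then L j else 0 := by
    intro j
    simp only [Fin.castSucc_lt_succ_iff, Fin.castSucc_lt_castSucc_iff]
    rcases lt_trichotomy j i with h | h | h
    · simp [h, h.le, h.ne]
    · simp [h]
    · simp [h.not_gt, h.not_ge, h.ne']
  rw [layerInfo, Set.empty_union, Set.empty_union, hB.H_layersBefore, hB.H_layersBefore,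
    Finset.sum_congr rfl fun j _ => h1 j, Finset.sum_add_distrib, Finset.sum_ite_eq',
    if_pos (Finset.mem_univ i)]
  ring

theorem layerInfo_le (hB : EntropyBounds H X C L) (D : Set (Obj k n T)) (i : Fin n) :
    layerInfo H L D i ≤ L i := by
  have := hB.poly.mono (A := D ∪ Obj.layersBefore i.castSucc) (B := D ∪ Obj.layersBefore i.succ)
    (Set.union_subset_union_right _ (by rw [layersBefore_succ]; exact Set.subset_insert _ _))
  unfold layerInfo
  linarith

theorem sum_sub_layerInfo (D : Set (Obj k n T)) :
    ∑ i, (L i - layerInfo H L D i) = H (D ∪ Obj.layersBefore (Fin.last n)) - H D := by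
  have h0 : (Obj.layersBefore 0 : Set (Obj k n T)) = ∅ := by
    ext a
    simp [Obj.layersBefore]
  have := sum_succ_sub_castSucc fun i : Fin (n + 1) => H (D ∪ Obj.layersBefore i)
  rw [h0, Set.union_empty] at this
  rw [← this]
  exact Finset.sum_congr rfl fun i _ => by rw [layerInfo]; ring

theorem sum_layerInfo_le (hB : EntropyBounds H X C L) (D : Set (Obj k n T)) :
    ∑ i, layerInfo H L D i ≤ H D := by
  have h1 := sum_sub_layerInfo (H := H) (L := L) D
  rw [Finset.sum_sub_distrib] at h1
  have h2 := hB.poly.mono (Set.subset_union_right (s := D) (t := Obj.layersBefore (Fin.last n)))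
  rw [hB.H_layersBefore_last] at h2
  linarith

/-- This is the chain rule with the layers of `S` in increasing order: conditioning on all earlier
layers, and not just those in `S`, can only lower each term. -/
theorem sum_sub_layerInfo_le (hB : EntropyBounds H X C L) (D : Set (Obj k n T))
    (S : Finset (Fin n)) :
    ∑ i ∈ S, (L i - layerInfo H L D i) ≤ H (D ∪ Sum.inl '' (S : Set (Fin n))) - H D := by
  induction S using Finset.induction_on_max with
  | empty => simp
  | insert a S ha ih =>
    rw [Finset.sum_insert fun h => lt_irrefl a (ha a h)]
    have := hB.poly.submod' (A := D ∪ Sum.inl '' ((insert a S : Finset (Fin n)) : Set (Fin n)))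
      (B := D ∪ Obj.layersBefore a.castSucc)
      (U := D ∪ Obj.layersBefore a.succ) (D := D ∪ Sum.inl '' (S : Set (Fin n)))
      (by
        rw [layersBefore_succ]
        intro x
        simp only [Set.mem_union, Set.mem_insert_iff, Set.mem_image, Finset.coe_insert]
        grind)
      (Set.union_subset_union_right _ (Set.image_mono (by simp)))
      (Set.union_subset_union_right _ (by
        rintro _ ⟨j, hj, rfl⟩
        exact ⟨j, Fin.castSucc_lt_castSucc_iff.2 (ha j hj), rfl⟩))
    have h2 : L a - layerInfo H L D a
        = H (D ∪ Obj.layersBefore a.succ) - H (D ∪ Obj.layersBefore a.castSucc) := by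
      rw [layerInfo]; ring
    linarith

end EntropyBounds

end Network

section Margin

variable {k n : ℕ} (X : Fin (n + 1) → Finset (Fin (k + 1))) (C : Fin (k + 1) → ℝ)
  (L : Fin n → ℝ)

theorem margin_last : margin X C L (Fin.last n) = 0 := by
  simp [margin]

theorem margin_castSucc (j : Fin n) : margin X C L j.castSucc
    = ∑ i, (if j ≤ i then (peerCount (X i.castSucc) : ℝ) * L i else L i)
      - ∑ p ∈ X j.castSucc, C p := by
  rw [margin, Fin.snoc_castSucc, Finset.sum_ite]
  congr 3
  · ext i; simp
  · ext i; simp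

end Margin

/-! ### The two families of inequalities behind the converse -/

namespace EntropyBounds

variable {k n T : ℕ} {H : Set (Obj k n T) → ℝ} {X : Fin (n + 1) → Finset (Fin (k + 1))}
  {C : Fin (k + 1) → ℝ} {L : Fin n → ℝ}

/-- Redundant reception, meaning what inboxes contain beyond the demanded layers, must account for
everything that helpers learn about layers they do not demand. A telescoping potential measures
this. -/
theorem sum_add_sum_layerInfo_le (hB : EntropyBounds H X C L) (hX : Antitone X)
    (hX_first : X 0 = Finset.univ) (hX_last : X (Fin.last n) = {0}) :
    ∑ i : Fin n, (peerCount (X i.castSucc) : ℝ) * L i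
      + ∑ i : Fin n, layerInfo H L (Obj.outside (X i.castSucc)) i ≤ ∑ u, C u := by
  -- Passing from `i` to `i + 1` reveals layer `i`, and then the inboxes of the peers for which it
  -- is the last demanded layer.
  set Φ : Fin (n + 1) → ℝ := fun i => H (Obj.outside (X i) ∪ Obj.layersBefore i) with hΦ
  set ℓ : Fin (k + 1) → ℝ := fun v => ∑ j : Fin n, if v ∈ X j.castSucc then L j else 0 with hℓ
  -- For a peer, this is the entropy of its inbox given the layers that it demands, since those
  -- layers are determined by the inbox.
  set F : Fin (k + 1) → ℝ := fun v => H (Obj.inbox v) - ℓ v with hF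
  have zero_mem : ∀ i, (0 : Fin (k + 1)) ∈ X i := fun i =>
    hX (Fin.le_last i) (by rw [hX_last]; exact Finset.mem_singleton_self 0)
  have step : ∀ i : Fin n, Φ i.succ - Φ i.castSucc
      ≤ L i - layerInfo H L (Obj.outside (X i.castSucc)) i
        - (∑ v ∈ X i.succ, F v - ∑ v ∈ X i.castSucc, F v) := by
    intro i
    have hsub : X i.succ ⊆ X i.castSucc := hX i.castSucc_lt_succ.le
    have h1 := hB.poly.union_biUnion_le (fun v => Obj.inbox v) (X i.castSucc \ X i.succ)
      (D := Obj.outside (X i.castSucc) ∪ Obj.layersBefore i.succ) (E := Obj.layersBefore i.succ)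
      Set.subset_union_right
    have h2 : Φ i.succ ≤ H ((Obj.outside (X i.castSucc) ∪ Obj.layersBefore i.succ) ∪
        ⋃ v ∈ X i.castSucc \ X i.succ, Obj.inbox v) := by
      refine hB.poly.mono ?_
      rintro a (⟨t, u, v, hv, rfl⟩ | ha)
      · by_cases hv' : v ∈ X i.castSucc
        · refine Or.inr ?_
          simp only [Set.mem_iUnion]
          exact ⟨v, Finset.mem_sdiff.2 ⟨hv', hv⟩, t, u, rfl⟩
        · exact Or.inl (Or.inl ⟨t, u, v, hv', rfl⟩)
      · exact Or.inl (Or.inr ha)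
    have h3 : ∀ v ∈ X i.castSucc \ X i.succ,
        H (Obj.inbox v ∪ Obj.layersBefore i.succ) - H (Obj.layersBefore i.succ) = F v := by
      intro v hv
      rw [Finset.mem_sdiff] at hv
      have hv0 : v ≠ 0 := fun h => hv.2 (h ▸ zero_mem _)
      have hiff : ∀ j : Fin n, j.castSucc < i.succ ↔ v ∈ X j.castSucc := by
        intro j
        constructor
        · exact fun h => hX (Fin.castSucc_le_castSucc_iff.2 (Fin.castSucc_lt_succ_iff.1 h)) hv.1
        · exact fun h => lt_of_not_ge fun h' => hv.2 (hX h' h)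
      rw [hB.poly.union_eq_of_determined, hB.H_layersBefore, hF]
      · simp only [hiff, hℓ]
      · rintro _ ⟨j, hj, rfl⟩
        exact hB.decode j v ((hiff j).1 hj) hv0
    rw [Finset.sum_congr rfl h3] at h1
    have h4 := Finset.sum_sdiff (f := F) hsub
    have h5 : H (Obj.outside (X i.castSucc) ∪ Obj.layersBefore i.succ)
        = L i - layerInfo H L (Obj.outside (X i.castSucc)) i + Φ i.castSucc := by
      rw [layerInfo, hΦ]; ring
    linarith
  have hsum := Finset.sum_le_sum fun i (_ : i ∈ Finset.univ) => step i
  rw [sum_succ_sub_castSucc, Finset.sum_sub_distrib, Finset.sum_sub_distrib,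
    sum_succ_sub_castSucc (fun i => ∑ v ∈ X i, F v), hX_last, hX_first] at hsum
  have hΦ0 : Φ 0 = 0 := by
    have : (Obj.outside (X 0) ∪ Obj.layersBefore 0 : Set (Obj k n T)) = ∅ := by
      ext a
      simp [Obj.outside, Obj.layersBefore, hX_first]
    rw [hΦ, ← hB.poly.empty, ← this]
  have hΦn : ∑ j, L j ≤ Φ (Fin.last n) := by
    rw [← hB.H_layersBefore_last]
    exact hB.poly.mono Set.subset_union_right
  have hFsum : ∑ v, F v - ∑ v ∈ {0}, F v = ∑ v ∈ Finset.univ.erase 0, F v := by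
    rw [Finset.sum_erase_eq_sub (Finset.mem_univ _), Finset.sum_singleton]
  have hℓsum : ∑ v ∈ Finset.univ.erase 0, ℓ v
      = ∑ i : Fin n, (peerCount (X i.castSucc) : ℝ) * L i := by
    rw [hℓ, Finset.sum_comm]
    refine Finset.sum_congr rfl fun j _ => ?_
    rw [← Finset.sum_filter, Finset.sum_const, nsmul_eq_mul, peerCount]
    congr 3
    ext v
    simp
  have hin : ∑ v ∈ Finset.univ.erase 0, H (Obj.inbox v) ≤ ∑ u, C u := by
    calc ∑ v ∈ Finset.univ.erase 0, H (Obj.inbox v) ≤ ∑ v, H (Obj.inbox v) :=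
          Finset.sum_le_sum_of_subset_of_nonneg (Finset.subset_univ _)
            fun v _ _ => hB.poly.nonneg _
      _ ≤ ∑ v, ∑ u, H (Obj.link u v) := by
          refine Finset.sum_le_sum fun v _ => le_trans (hB.poly.mono ?_)
            (hB.poly.biUnion_le (fun u => Obj.link u v) Finset.univ)
          rintro _ ⟨t, u, rfl⟩
          simp only [Set.mem_iUnion]
          exact ⟨u, Finset.mem_univ u, t, rfl⟩
      _ = ∑ u, ∑ v, H (Obj.link u v) := Finset.sum_comm
      _ ≤ ∑ u, C u := Finset.sum_le_sum fun u _ => hB.capacity u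
  have hFs : ∑ v ∈ Finset.univ.erase 0, F v = ∑ v ∈ Finset.univ.erase 0, H (Obj.inbox v)
      - ∑ v ∈ Finset.univ.erase 0, ℓ v := Finset.sum_sub_distrib _ _
  linarith

/-- All that nodes outside `A` ever receive is determined, by induction on the round, by the links
that cross from `A` to its complement. -/
theorem H_outside_le (hB : EntropyBounds H X C L) {A : Finset (Fin (k + 1))} (h0 : 0 ∈ A) :
    H (Obj.outside A) ≤ ∑ v ∈ Aᶜ, ∑ u ∈ A, H (Obj.link u v) := by
  set B : Set (Obj k n T) := ⋃ v ∈ Aᶜ, ⋃ u ∈ A, Obj.link u v with hBdef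
  have hmsg : ∀ m : ℕ, ∀ t : Fin T, (t : ℕ) = m → ∀ u, ∀ w ∉ A,
      H (insert (Sum.inr (t, u, w)) B) = H B := by
    intro m
    induction m using Nat.strong_induction_on with
    | _ m ih =>
      intro t ht u w hw
      by_cases hu : u ∈ A
      · refine IsPolymatroid.determined_of_mem ?_
        simp only [hBdef, Set.mem_iUnion]
        exact ⟨w, Finset.mem_compl.2 hw, u, hu, t, rfl⟩
      · refine hB.poly.determined_trans (A := Obj.inboxBefore t u) ?_
          (hB.causal t u w fun h => hu (h ▸ h0))
        rintro _ ⟨s, hs, x, rfl⟩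
        exact ih s (ht ▸ hs) s rfl x u hu
  calc H (Obj.outside A) ≤ H (B ∪ Obj.outside A) := hB.poly.mono Set.subset_union_right
    _ = H B := by
      refine hB.poly.union_eq_of_determined ?_
      rintro _ ⟨t, u, v, hv, rfl⟩
      exact hmsg t t rfl u v hv
    _ ≤ ∑ v ∈ Aᶜ, H (⋃ u ∈ A, Obj.link u v) := hB.poly.biUnion_le _ _
    _ ≤ ∑ v ∈ Aᶜ, ∑ u ∈ A, H (Obj.link u v) :=
      Finset.sum_le_sum fun v _ => hB.poly.biUnion_le _ _

/-- Given what the outside has received, its messages to `v` carry nothing new. What `v` still lacks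
of its layers must therefore come from `A`. -/
theorem sum_demanded_le (hB : EntropyBounds H X C L) {A : Finset (Fin (k + 1))} (h0 : 0 ∈ A)
    {v : Fin (k + 1)} (hv : v ≠ 0) :
    ∑ i : Fin n with v ∈ X i.castSucc, (L i - layerInfo H L (Obj.outside A) i)
      ≤ ∑ u ∈ A, H (Obj.link u v) := by
  refine (hB.sum_sub_layerInfo_le (Obj.outside A) _).trans ?_
  set W : Set (Obj k n T) := Obj.outside A ∪ ⋃ u ∈ A, Obj.link u v with hW
  have hin : ∀ a ∈ (Obj.inbox v : Set (Obj k n T)), H (insert a W) = H W := by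
    rintro _ ⟨t, u, rfl⟩
    by_cases hu : u ∈ A
    · refine IsPolymatroid.determined_of_mem (Or.inr ?_)
      simp only [Set.mem_iUnion]
      exact ⟨u, hu, t, rfl⟩
    · refine hB.poly.determined_mono ?_ (hB.causal t u v fun h => hu (h ▸ h0))
      rintro _ ⟨s, -, x, rfl⟩
      exact Or.inl ⟨s, x, u, hu, rfl⟩
  have h1 : H (Obj.outside A ∪ Sum.inl ''
      ((Finset.univ.filter fun i : Fin n => v ∈ X i.castSucc : Finset (Fin n)) : Set (Fin n)))
      ≤ H W := by
    rw [← hB.poly.union_eq_of_determined (B := W) (A := Sum.inl ''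
      ((Finset.univ.filter fun i : Fin n => v ∈ X i.castSucc : Finset (Fin n)) : Set (Fin n)))]
    · exact hB.poly.mono (Set.union_subset_union_left _ Set.subset_union_left)
    · rintro _ ⟨i, hi, rfl⟩
      exact hB.poly.determined_trans hin (hB.decode i v (by simpa using hi) hv)
  have h2 := hB.poly.union_le (Obj.outside A) (⋃ u ∈ A, Obj.link u v)
  have h3 := hB.poly.biUnion_le (fun u => Obj.link u v) A
  linarith

/-- The nodes of `A = X_j` pay both for the information leaving `A`, at least `∑ g i`, and for what
each peer of `A` needs beyond it. Each unit of `g i` thus saves `|X_i|` deliveries and costs one,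
whence the factor `|X_i| - 1`. -/
theorem margin_le (hB : EntropyBounds H X C L) (hX : Antitone X)
    (hX_last : X (Fin.last n) = {0}) (hX_peer : ∀ j : Fin n, ∃ i ∈ X j.castSucc, i ≠ 0)
    (j : Fin n) :
    margin X C L j.castSucc ≤ ∑ i, if j ≤ i then ((peerCount (X i.castSucc) : ℝ) - 1)
      * layerInfo H L (Obj.outside (X i.castSucc)) i else 0 := by
  set A := X j.castSucc with hA
  set g : Fin n → ℝ := layerInfo H L (Obj.outside A) with hg
  have h0 : (0 : Fin (k + 1)) ∈ A :=
    hX (Fin.le_last _) (by rw [hX_last]; exact Finset.mem_singleton_self 0)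
  have hpos : ∀ i : Fin n, (1 : ℝ) ≤ peerCount (X i.castSucc) := by
    intro i
    obtain ⟨v, hv, hv0⟩ := hX_peer i
    exact_mod_cast Finset.card_pos.2 ⟨v, Finset.mem_erase.2 ⟨hv0, hv⟩⟩
  have hcut : H (Obj.outside A)
      + ∑ v ∈ A.erase 0, ∑ i : Fin n with v ∈ X i.castSucc, (L i - g i) ≤ ∑ u ∈ A, C u := by
    calc _ ≤ ∑ v ∈ Aᶜ, ∑ u ∈ A, H (Obj.link u v)
          + ∑ v ∈ A.erase 0, ∑ u ∈ A, H (Obj.link u v) :=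
          add_le_add (hB.H_outside_le h0) (Finset.sum_le_sum fun v hv =>
            hB.sum_demanded_le h0 (Finset.ne_of_mem_erase hv))
      _ ≤ ∑ v ∈ Aᶜ, ∑ u ∈ A, H (Obj.link u v) + ∑ v ∈ A, ∑ u ∈ A, H (Obj.link u v) := by
          gcongr
          · exact fun v _ _ => Finset.sum_nonneg fun u _ => hB.poly.nonneg _
          · exact Finset.erase_subset _ _
      _ = ∑ u ∈ A, ∑ v, H (Obj.link u v) := by
          rw [add_comm, Finset.sum_add_sum_compl, Finset.sum_comm]
      _ ≤ ∑ u ∈ A, C u := Finset.sum_le_sum fun u _ => hB.capacity u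
  have hcount : ∑ i, (if j ≤ i then (peerCount (X i.castSucc) : ℝ) * (L i - g i) else L i - g i)
      ≤ ∑ v ∈ A.erase 0, ∑ i : Fin n with v ∈ X i.castSucc, (L i - g i) := by
    simp only [Finset.sum_filter]
    rw [Finset.sum_comm]
    refine Finset.sum_le_sum fun i _ => ?_
    have hnn : 0 ≤ L i - g i := sub_nonneg.2 (hB.layerInfo_le _ i)
    rw [← Finset.sum_filter, Finset.sum_const, nsmul_eq_mul]
    split_ifs with hij
    · refine le_of_eq ?_
      rw [peerCount]
      congr 3
      have := hX (Fin.castSucc_le_castSucc_iff.2 hij)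
      ext v
      simp only [Finset.mem_erase, Finset.mem_filter]
      exact ⟨fun h => ⟨⟨h.1, this h.2⟩, h.2⟩, fun h => ⟨h.1.1, h.2⟩⟩
    -- For `i < j` every peer of `A` demands layer `i`, but only one copy is retained, as in the
    -- margin.
    · refine le_mul_of_one_le_left hnn ((hpos j).trans ?_)
      have := hX (Fin.castSucc_le_castSucc_iff.2 (not_le.1 hij).le)
      rw [peerCount]
      exact_mod_cast Finset.card_le_card fun v hv =>
        Finset.mem_filter.2 ⟨hv, this (Finset.mem_of_mem_erase hv)⟩
  have hD := hB.sum_layerInfo_le (Obj.outside A)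
  rw [margin_castSucc]
  have hfin : ∑ i, (if j ≤ i then (peerCount (X i.castSucc) : ℝ) * L i else L i)
      - ∑ i, (if j ≤ i then (peerCount (X i.castSucc) : ℝ) * (L i - g i) else L i - g i)
      - ∑ i, g i ≤ ∑ i, if j ≤ i then ((peerCount (X i.castSucc) : ℝ) - 1)
      * layerInfo H L (Obj.outside (X i.castSucc)) i else 0 := by
    rw [← Finset.sum_sub_distrib, ← Finset.sum_sub_distrib]
    refine Finset.sum_le_sum fun i _ => ?_
    split_ifs with hij
    -- The cut yields information relative to `X_j`; enlarging the outside to that of `X_i` makes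
    -- the same `g i` serve all `j`.
    · have hout : (Obj.outside A : Set (Obj k n T)) ⊆ Obj.outside (X i.castSucc) := by
        rintro _ ⟨t, u, v, hv, rfl⟩
        exact ⟨t, u, v, fun h => hv (hX (Fin.castSucc_le_castSucc_iff.2 hij) h), rfl⟩
      have := mul_le_mul_of_nonneg_left (hB.layerInfo_mono hout i) (sub_nonneg.2 (hpos i))
      linarith
    · linarith
  linarith

end EntropyBounds

/-! ### The dominant subsequence as the drops of a running maximum; the linear program -/

section DominantSubsequence

variable {n h : ℕ}

/-- The running maximum from the right: the maximum of `a i` over `i ≥ j`. -/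
noncomputable def tailMax (a : Fin (n + 1) → ℝ) (j : Fin (n + 1)) : ℝ :=
  (Finset.Ici j).sup' Finset.nonempty_Ici a

theorem le_tailMax (a : Fin (n + 1) → ℝ) {i j : Fin (n + 1)} (hij : j ≤ i) :
    a i ≤ tailMax a j :=
  Finset.le_sup' a (Finset.mem_Ici.2 hij)

theorem tailMax_le {a : Fin (n + 1) → ℝ} {j : Fin (n + 1)} {b : ℝ} (hb : ∀ i, j ≤ i → a i ≤ b) :
    tailMax a j ≤ b :=
  Finset.sup'_le _ _ fun i hi => hb i (Finset.mem_Ici.1 hi)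

theorem tailMax_antitone (a : Fin (n + 1) → ℝ) : Antitone (tailMax a) :=
  fun _ _ hij => tailMax_le fun _ hl => le_tailMax a (hij.trans hl)

theorem tailMax_last (a : Fin (n + 1) → ℝ) : tailMax a (Fin.last n) = a (Fin.last n) :=
  le_antisymm (tailMax_le fun i hi => by rw [Fin.last_le_iff.1 hi]) (le_tailMax a le_rfl)

theorem tailMax_castSucc (a : Fin (n + 1) → ℝ) (j : Fin n) :
    tailMax a j.castSucc = max (a j.castSucc) (tailMax a j.succ) := by
  refine le_antisymm (tailMax_le fun i hi => ?_)
    (max_le (le_tailMax a le_rfl) (tailMax_antitone a j.castSucc_lt_succ.le))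
  rcases hi.eq_or_lt with rfl | hi
  · exact le_max_left _ _
  · exact le_max_of_le_right (le_tailMax a (Fin.castSucc_lt_iff_succ_le.1 hi))

namespace IsDominantSubsequence

variable {a : Fin (n + 1) → ℝ} {d : Fin (h + 1) → Fin (n + 1)}

theorem castSucc_lt_succ (hd : IsDominantSubsequence a d) (i : Fin h) :
    d i.castSucc < d i.succ :=
  (hd.step i).1.1

theorem strictMono (hd : IsDominantSubsequence a d) : StrictMono d :=
  Fin.strictMono_iff_lt_succ.2 hd.castSucc_lt_succ

theorem le_of_le (hd : IsDominantSubsequence a d) (i : Fin (h + 1)) :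
    ∀ j, d i ≤ j → a j ≤ a (d i) := by
  induction i using Fin.reverseInduction with
  | last =>
    intro j hj
    rw [hd.last, Fin.last_le_iff] at hj
    rw [hj, hd.last]
  | cast i ih =>
    intro j hj
    rcases hj.eq_or_lt with rfl | hj
    · exact le_rfl
    by_contra hlt
    rw [not_le] at hlt
    have h1 : a (d i.succ) < a j := (hd.step i).1.2.trans hlt
    rcases lt_or_ge j (d i.succ) with h2 | h2
    · exact absurd ((hd.step i).2 ⟨h2, h1⟩) (not_le.2 hj)
    · exact absurd (ih j h2) (not_le.2 h1)

theorem le_of_lt (hd : IsDominantSubsequence a d) (i : Fin h) (j : Fin (n + 1))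
    (hj : d i.castSucc < j) : a j ≤ a (d i.succ) := by
  by_contra hlt
  rw [not_le] at hlt
  rcases lt_or_ge j (d i.succ) with h2 | h2
  · exact absurd ((hd.step i).2 ⟨h2, hlt⟩) (not_le.2 hj)
  · exact absurd (hd.le_of_le _ j h2) (not_le.2 hlt)

theorem tailMax_eq (hd : IsDominantSubsequence a d) (i : Fin (h + 1)) :
    tailMax a (d i) = a (d i) :=
  le_antisymm (tailMax_le (hd.le_of_le i)) (le_tailMax a le_rfl)

/-- A drop at `j` means that `a j` exceeds all later terms. Walking left from the end, the
maximality in the choice of each index forbids skipping `j`. -/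
theorem exists_eq_of_tailMax_ne (hd : IsDominantSubsequence a d) {j : Fin n}
    (hj : tailMax a j.castSucc ≠ tailMax a j.succ) : ∃ i : Fin h, d i.castSucc = j.castSucc := by
  have hlt : tailMax a j.succ < a j.castSucc := by
    by_contra hle
    rw [tailMax_castSucc, max_eq_right (not_lt.1 hle)] at hj
    exact hj rfl
  have key : ∀ i : Fin (h + 1), j.castSucc < d i → ∃ i : Fin h, d i.castSucc = j.castSucc := by
    intro i
    induction i using Fin.induction with
    | zero =>
      intro hi
      exact absurd ⟨_, hi, (le_tailMax a (Fin.castSucc_lt_iff_succ_le.1 hi)).trans_lt hlt⟩ hd.first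
    | succ i ih =>
      intro hi
      rcases lt_trichotomy (d i.castSucc) j.castSucc with h1 | h1 | h1
      · exact absurd ((hd.step i).2
          ⟨hi, (le_tailMax a (Fin.castSucc_lt_iff_succ_le.1 hi)).trans_lt hlt⟩) (not_le.2 h1)
      · exact ⟨i, h1⟩
      · exact ih h1
  exact key (Fin.last h) (by rw [hd.last]; exact Fin.castSucc_lt_last j)

/-- The running maximum is constant between consecutive dominant indices, so all other terms vanish.
-/
theorem sum_eq_sum_tailMax (hd : IsDominantSubsequence a d) (w : Fin (n + 1) → ℝ) :
    ∑ i : Fin h, (a (d i.castSucc) - a (d i.succ)) / w (d i.castSucc)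
      = ∑ j : Fin n, (tailMax a j.castSucc - tailMax a j.succ) / w j.castSucc := by
  have hlast : ∀ i : Fin h, d i.castSucc ≠ Fin.last n := fun i =>
    ((hd.castSucc_lt_succ i).trans_le (Fin.le_last _)).ne
  refine Finset.sum_of_injOn (fun i => (d i.castSucc).castPred (hlast i)) ?_ (by simp) ?_ ?_
  · intro i _ i' _ hii
    have := congrArg Fin.castSucc hii
    simp only [Fin.castSucc_castPred] at this
    exact Fin.castSucc_injective _ (hd.strictMono.injective this)
  · intro j _ hj
    rw [div_eq_zero_iff, sub_eq_zero]
    left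
    by_contra hne
    obtain ⟨i, hi⟩ := hd.exists_eq_of_tailMax_ne hne
    exact hj ⟨i, by simp, Fin.castSucc_injective _ (by simpa using hi)⟩
  · intro i _
    simp only [Fin.castSucc_castPred]
    rw [hd.tailMax_eq]
    congr 2
    set j := (d i.castSucc).castPred (hlast i) with hj
    have hj' : d i.castSucc = j.castSucc := by rw [hj, Fin.castSucc_castPred]
    refine le_antisymm (le_tailMax a ?_) (tailMax_le fun l hl => hd.le_of_lt i l ?_)
    · exact Fin.castSucc_lt_iff_succ_le.1 (hj' ▸ hd.castSucc_lt_succ i)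
    · rw [hj']
      exact j.castSucc_lt_succ.trans_le hl

end IsDominantSubsequence

end DominantSubsequence

/-- Weak duality for the linear program that distributes the required help over the layers. -/
theorem sum_tail_div_le_sum {n : ℕ} (M G : Fin (n + 1) → ℝ) (μ g : Fin n → ℝ)
    (hM : Antitone M) (hμ : Antitone μ) (hμ0 : ∀ i, 0 ≤ μ i) (hg : ∀ i, 0 ≤ g i)
    (hMG : ∀ i, M i ≤ G i) (hGM : G (Fin.last n) = M (Fin.last n))
    (hG : ∀ i : Fin n, G i.castSucc = G i.succ + μ i * g i)
    {c : ℝ} (hc : 0 ≤ c) (hcμ : ∀ i, c * μ i ≤ 1) :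
    ∑ i : Fin n, (M i.castSucc - M i.succ) / μ i + c * (G 0 - M 0) ≤ ∑ i, g i := by
  -- Here `c` is a price for the slack `G 0 - M 0`. In the step it is raised to `1 / μ 0`, which is
  -- still admissible later because `μ` is antitone.
  induction n generalizing c with
  | zero =>
    have : G 0 = M 0 := hGM
    simp [this]
  | succ n ih =>
    have ih' := fun c hc hcμ => ih (fun i => M i.succ) (fun i => G i.succ) (fun i => μ i.succ)
      (fun i => g i.succ) (fun i j hij => hM (Fin.succ_le_succ_iff.2 hij))
      (fun i j hij => hμ (Fin.succ_le_succ_iff.2 hij)) (fun i => hμ0 _) (fun i => hg _)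
      (fun i => hMG _) (by simpa using hGM) (fun i => hG i.succ) (c := c) hc hcμ
    rw [Fin.sum_univ_succ, Fin.sum_univ_succ (f := g)]
    have hG0 := hG 0
    have hM0 : M (Fin.succ 0) ≤ M 0 := hM (Fin.zero_le _)
    have hMG0 := hMG 0
    simp only [Fin.castSucc_zero, Fin.succ_castSucc] at hG0 ih' ⊢
    rcases (hμ0 0).eq_or_lt with h0 | h0
    -- If `μ 0 = 0`, the convention `x / 0 = 0` drops the term. Since `G` stays the same and `M`
    -- does not increase, the slack does not shrink.
    · have := ih' c hc fun i => hcμ _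
      rw [← h0, div_zero]
      rw [← h0, zero_mul, add_zero] at hG0
      have := mul_le_mul_of_nonneg_left hM0 hc
      have := hg 0
      rw [hG0]
      linarith
    · have hc' : c ≤ 1 / μ 0 := by
        rw [le_div_iff₀ h0]
        exact hcμ 0
      have h1 := ih' (1 / μ 0) (by positivity) fun i => by
        rw [one_div, inv_mul_le_iff₀ h0, mul_one]
        exact hμ (Fin.zero_le _)
      have h2 := mul_le_mul_of_nonneg_right hc' (sub_nonneg.2 hMG0)
      have h3 : 1 / μ 0 * (G 0 - M 0) = 1 / μ 0 * (G (Fin.succ 0) - M (Fin.succ 0)) + g 0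
          - (M 0 - M (Fin.succ 0)) / μ 0 := by
        rw [hG0]
        field_simp
        ring
      linarith

/-! ### From schemes to entropy inequalities, and the converse -/

section Converse

variable {k n : ℕ} {X : Fin (n + 1) → Finset (Fin (k + 1))} {C : Fin (k + 1) → ℝ} {L : Fin n → ℝ}

theorem Scheme.Delivers.exists_entropyBounds {S : Scheme k n} (hS : S.Delivers X C L) :
    ∃ H : Set (Obj k n S.T) → ℝ, EntropyBounds H X C L := by
  -- Tagging layers and symbols puts them into one family, so all entropies in play are values of
  -- one set function.
  let Y : Obj k n S.T → S.Ω → S.Data ⊕ S.Msg := fun a ω =>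
    Sum.elim (fun j => Sum.inl (S.x j ω)) (fun p => Sum.inr (S.msg p.1 p.2.1 p.2.2 ω)) a
  have hpoly := isPolymatroid_jointEntropy S.P_nonneg S.P_sum Y
  have hinbox : ∀ v, entropy S.P (S.inbox v) = jointEntropy S.P Y (Obj.inbox v) := by
    intro v
    refine entropy_eq_jointEntropy fun ω ω' => ?_
    simp only [Obj.inbox, Scheme.inbox, Scheme.link, funext_iff, Set.mem_ofPred_eq,
      forall_exists_index, Y]
    constructor
    · rintro h _ t u rfl
      simp [h u t]
    · intro h u t
      simpa using h _ t u rfl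
  have hinbox' : ∀ v j, entropy S.P (fun ω => (S.inbox v ω, S.x j ω))
      = jointEntropy S.P Y (insert (Sum.inl j) (Obj.inbox v)) := by
    intro v j
    refine entropy_eq_jointEntropy fun ω ω' => ?_
    simp only [Obj.inbox, Scheme.inbox, Scheme.link, funext_iff, Set.mem_ofPred_eq,
      forall_exists_index, Y, Prod.mk.injEq, Set.forall_mem_insert]
    constructor
    · rintro ⟨h, hj⟩
      refine ⟨by simp [hj], ?_⟩
      rintro _ t u rfl
      simp [h u t]
    · rintro ⟨hj, h⟩
      exact ⟨fun u t => by simpa using h _ t u rfl, by simpa using hj⟩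
  refine ⟨jointEntropy S.P Y, hpoly, ?_, ?_, ?_, ?_⟩
  · intro A
    rw [← Finset.sum_congr rfl fun j _ => hS.rate j,
      ← jointEntropy_of_independent S.P_nonneg S.P_sum hS.indep]
    exact (entropy_eq_jointEntropy fun ω ω' => by simp [Y, funext_iff]).symm
  · intro t u v hu
    have := hS.causal t u v hu
    rw [condEntropy, sub_eq_zero] at this
    rw [entropy_eq_jointEntropy (Y := Y) (A := insert (Sum.inr (t, u, v)) (Obj.inboxBefore t u)),
      entropy_eq_jointEntropy (Y := Y) (A := Obj.inboxBefore t u)] at this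
    · exact this
    · intro ω ω'
      simp only [Obj.inboxBefore, Scheme.inboxBefore, funext_iff, Set.mem_ofPred_eq, Y,
        Subtype.forall]
      constructor
      · rintro h _ ⟨s, hs, w, rfl⟩
        simp [h w s hs]
      · intro h w s hs
        simpa using h _ ⟨s, hs, w, rfl⟩
    · intro ω ω'
      simp only [Obj.inboxBefore, Scheme.inboxBefore, funext_iff, Set.mem_ofPred_eq, Y,
        Subtype.forall, Prod.mk.injEq, Set.forall_mem_insert]
      constructor
      · rintro ⟨hm, h⟩
        refine ⟨by simp [hm], ?_⟩
        rintro _ ⟨s, hs, w, rfl⟩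
        simp [h w s hs]
      · rintro ⟨hm, h⟩
        exact ⟨by simpa using hm, fun w s hs => by simpa using h _ ⟨s, hs, w, rfl⟩⟩
  · intro u
    refine le_trans (le_of_eq (Finset.sum_congr rfl fun v _ => ?_)) (hS.capacity u)
    refine (entropy_eq_jointEntropy fun ω ω' => ?_).symm
    simp only [Obj.link, Scheme.link, funext_iff, Set.mem_ofPred_eq, forall_exists_index, Y]
    constructor
    · rintro h _ t rfl
      simp [h t]
    · intro h t
      simpa using h _ t rfl
  · intro j v hv hv0
    have := hS.decode j v hv hv0
    rw [mutualInfo, hinbox, hinbox'] at this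
    linarith

theorem inRegion_of_achievable {h : ℕ} {d : Fin (h + 1) → Fin (n + 1)} (hX : Antitone X)
    (hX_first : X 0 = Finset.univ) (hX_last : X (Fin.last n) = {0})
    (hX_peer : ∀ j : Fin n, ∃ i ∈ X j.castSucc, i ≠ 0) (hC : ∀ i, 0 ≤ C i)
    (hd : IsDominantSubsequence (margin X C L) d) (hA : Achievable X C L) :
    InRegion X C L d := by
  obtain ⟨S, hS⟩ := hA
  obtain ⟨H, hB⟩ := hS.exists_entropyBounds
  have hpos : ∀ i : Fin n, (1 : ℝ) ≤ peerCount (X i.castSucc) := by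
    intro i
    obtain ⟨v, hv, hv0⟩ := hX_peer i
    exact_mod_cast Finset.card_pos.2 ⟨v, Finset.mem_erase.2 ⟨hv0, hv⟩⟩
  constructor
  · rcases n with _ | n
    · simpa using hC 0
    · obtain ⟨v, hv, hv0⟩ := hX_peer (Fin.last n)
      exact hB.sum_le_source hv0 fun j =>
        hX (Fin.castSucc_le_castSucc_iff.2 (Fin.le_last j)) hv
  · rw [hd.sum_eq_sum_tailMax (fun i => (peerCount (X i) : ℝ) - 1), hX_first]
    refine le_trans ?_ (hB.sum_add_sum_layerInfo_le hX hX_first hX_last)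
    refine add_le_add le_rfl ?_
    set μ : Fin n → ℝ := fun i => (peerCount (X i.castSucc) : ℝ) - 1 with hμ
    set g : Fin n → ℝ := fun i => layerInfo H L (Obj.outside (X i.castSucc)) i with hg
    have hμ0 : ∀ i, 0 ≤ μ i := fun i => sub_nonneg.2 (hpos i)
    have hg0 : ∀ i, 0 ≤ g i := fun i => hB.layerInfo_nonneg _ i
    have hlast : tailMax (margin X C L) (Fin.last n) = 0 := by
      rw [tailMax_last, margin_last]
    set G : Fin (n + 1) → ℝ := fun j => ∑ i : Fin n, if j ≤ i.castSucc then μ i * g i else 0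
      with hG
    have hGlast : G (Fin.last n) = 0 := Finset.sum_eq_zero fun i _ =>
      if_neg (not_le.2 (Fin.castSucc_lt_last i))
    have hGanti : Antitone G := by
      intro i j hij
      refine Finset.sum_le_sum fun l _ => ?_
      have := mul_nonneg (hμ0 l) (hg0 l)
      by_cases hjl : j ≤ l.castSucc
      · rw [if_pos hjl, if_pos (hij.trans hjl)]
      · rw [if_neg hjl]
        split_ifs <;> linarith
    have hMG : ∀ j, tailMax (margin X C L) j ≤ G j := by
      refine fun j => tailMax_le fun i hi => le_trans ?_ (hGanti hi)
      induction i using Fin.lastCases with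
      | last => rw [margin_last, hGlast]
      | cast i =>
        refine (hB.margin_le hX hX_last hX_peer i).trans (le_of_eq ?_)
        exact Finset.sum_congr rfl fun l _ => by simp only [Fin.castSucc_le_castSucc_iff, hμ, hg]
    -- The price of the initial slack is taken to be `c = 0`.
    have := sum_tail_div_le_sum (tailMax (margin X C L)) G μ g (tailMax_antitone _)
      (fun i j hij => sub_le_sub_right (by
        exact_mod_cast Finset.card_le_card
          (Finset.erase_subset_erase 0 (hX (Fin.castSucc_le_castSucc_iff.2 hij)))) 1)
      hμ0 hg0 hMG (hGlast.trans hlast.symm) (fun i => by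
        have h1 : ∀ l : Fin n, (if i.castSucc ≤ l.castSucc then μ l * g l else 0)
            = (if i.succ ≤ l.castSucc then μ l * g l else 0) + if l = i then μ i * g i else 0 := by
          intro l
          simp only [Fin.castSucc_le_castSucc_iff, Fin.succ_le_castSucc_iff]
          rcases lt_trichotomy i l with h | h | h
          · simp [h, h.le, h.ne']
          · simp [h]
          · simp [h.not_gt, h.not_ge, h.ne]
        rw [hG]
        simp only
        rw [Finset.sum_congr rfl fun l _ => h1 l, Finset.sum_add_distrib]
        simp) le_rfl (fun i => by simp)
    simpa using this

end Converse

/-! ### Allocation of upload capacity -/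

section Allocation

variable {V : Type} [Fintype V]

theorem exists_le_sum_eq {c : V → ℝ} (hc : ∀ v, 0 ≤ c v) (A : Finset V) {R : ℝ} (hR : 0 ≤ R)
    (hRc : R ≤ ∑ v ∈ A, c v) :
    ∃ y : V → ℝ, (∀ v, 0 ≤ y v) ∧ (∀ v, y v ≤ c v) ∧ (∀ v ∉ A, y v = 0) ∧ ∑ v, y v = R := by
  classical
  set s := ∑ v ∈ A, c v with hs
  have hs0 : 0 ≤ s := hR.trans hRc
  refine ⟨fun v => if v ∈ A then c v * (R / s) else 0, fun v => ?_, fun v => ?_, fun v hv => ?_, ?_⟩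
  · dsimp only
    split_ifs
    · exact mul_nonneg (hc v) (div_nonneg hR hs0)
    · exact le_rfl
  · dsimp only
    split_ifs
    · exact mul_le_of_le_one_right (hc v) (div_le_one_of_le₀ hRc hs0)
    · exact hc v
  · exact if_neg hv
  · rw [Finset.sum_ite_mem, Finset.univ_inter, ← Finset.sum_mul, ← hs]
    rcases hs0.eq_or_lt with h | h
    · rw [← h] at hRc ⊢
      rw [zero_mul, le_antisymm hRc hR]
    · field_simp

/-- Transport with nested sets of admissible suppliers. -/
theorem exists_nested_transport {n : ℕ} {X : Fin n → Finset V} (hX : Antitone X) {R : Fin n → ℝ}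
    (hR : ∀ i, 0 ≤ R i) {c : V → ℝ} (hc : ∀ v, 0 ≤ c v)
    (hRc : ∀ j, ∑ i, (if j ≤ i then R i else 0) ≤ ∑ v ∈ X j, c v) :
    ∃ y : Fin n → V → ℝ, (∀ i v, 0 ≤ y i v) ∧ (∀ i, ∀ v ∉ X i, y i v = 0) ∧
      (∀ i, ∑ v, y i v = R i) ∧ ∀ v, ∑ i, y i v ≤ c v := by
  induction n generalizing c with
  | zero =>
    exact ⟨fun i => i.elim0, fun i => i.elim0, fun i => i.elim0, fun i => i.elim0,
      fun v => by simpa using hc v⟩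
  | succ n ih =>
    -- The most restricted demand is served first. Its suppliers lie in every other `X j`, so any
    -- choice of `z` uses up exactly `R (Fin.last n)` of each remaining bound.
    obtain ⟨z, hz0, hzc, hzX, hzR⟩ := exists_le_sum_eq hc (X (Fin.last n)) (hR (Fin.last n)) (by
      refine le_trans (le_of_eq ?_) (hRc (Fin.last n))
      simp [Fin.last_le_iff])
    obtain ⟨y, hy0, hyX, hyR, hyc⟩ := ih (X := fun i => X i.castSucc) (R := fun i => R i.castSucc)
      (c := fun v => c v - z v) (fun i j hij => hX (Fin.castSucc_le_castSucc_iff.2 hij))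
      (fun i => hR _) (fun v => sub_nonneg.2 (hzc v)) (fun j => by
        have h1 := hRc j.castSucc
        rw [Fin.sum_univ_castSucc, if_pos (Fin.le_last _)] at h1
        simp only [Fin.castSucc_le_castSucc_iff] at h1
        have h2 : ∑ v ∈ X j.castSucc, z v = R (Fin.last n) := by
          rw [← hzR]
          exact Finset.sum_subset (Finset.subset_univ _) fun v _ hv =>
            hzX v fun h => hv (hX (Fin.le_last _) h)
        rw [Finset.sum_sub_distrib]
        linarith)
    refine ⟨Fin.snoc (α := fun _ => V → ℝ) y z, ?_, ?_, ?_, ?_⟩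
    · intro i
      induction i using Fin.lastCases with
      | last => simpa using hz0
      | cast i => simpa using hy0 i
    · intro i
      induction i using Fin.lastCases with
      | last => simpa using hzX
      | cast i => simpa using hyX i
    · intro i
      induction i using Fin.lastCases with
      | last => simpa using hzR
      | cast i => simpa using hyR i
    · intro v
      rw [Fin.sum_univ_castSucc]
      simp only [Fin.snoc_castSucc, Fin.snoc_last]
      linarith [hyc v]

end Allocation

/-! ### Packet rates for the two-round scheme -/

section Rates

variable {k n : ℕ} {X : Fin (n + 1) → Finset (Fin (k + 1))} {C : Fin (k + 1) → ℝ} {L : Fin n → ℝ}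

theorem sum_tail_sub (M : Fin (n + 1) → ℝ) (j : Fin n) :
    ∑ i : Fin n, (if j ≤ i then M i.castSucc - M i.succ else 0)
      = M j.castSucc - M (Fin.last n) := by
  -- Truncating the index at `j` makes the differences before `j` vanish.
  have := sum_succ_sub_castSucc fun i => M (max i j.castSucc)
  rw [max_eq_left (Fin.le_last _), max_eq_right (Fin.zero_le _)] at this
  rw [← neg_sub, ← this, ← Finset.sum_neg_distrib]
  refine Finset.sum_congr rfl fun i _ => ?_
  split_ifs with h
  · rw [max_eq_left (Fin.castSucc_le_castSucc_iff.2 h),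
      max_eq_left ((Fin.castSucc_le_castSucc_iff.2 h).trans i.castSucc_lt_succ.le)]
    ring
  · rw [max_eq_right (Fin.castSucc_le_castSucc_iff.2 (not_le.1 h).le),
      max_eq_right (Fin.castSucc_lt_iff_succ_le.1 (Fin.castSucc_lt_castSucc_iff.2 (not_le.1 h)))]
    ring

/-- The part `r j v` of layer `j` that is relayed by node `v`. -/
theorem exists_rates (hX : Antitone X)
    (hX_last : X (Fin.last n) = {0}) (hX_peer : ∀ j : Fin n, ∃ i ∈ X j.castSucc, i ≠ 0)
    (hC : ∀ i, 0 ≤ C i) (hL : ∀ j, 0 ≤ L j) (hsource : ∑ j, L j ≤ C 0)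
    (htotal : ∑ j : Fin n, (peerCount (X j.castSucc) : ℝ) * L j
      + ∑ j : Fin n, (tailMax (margin X C L) j.castSucc - tailMax (margin X C L) j.succ)
        / ((peerCount (X j.castSucc) : ℝ) - 1) ≤ ∑ p, C p) :
    ∃ r : Fin n → Fin (k + 1) → ℝ, (∀ j v, 0 ≤ r j v) ∧ (∀ j, ∑ v, r j v = L j) ∧
      ∀ v, ∑ j : Fin n, ((peerCount (X j.castSucc) : ℝ) - if v ∈ X j.castSucc then 1 else 0) * r j v
        ≤ C v - if v = 0 then ∑ j, L j else 0 := by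
  set M := tailMax (margin X C L) with hM
  set μ : Fin n → ℝ := fun j => (peerCount (X j.castSucc) : ℝ) - 1 with hμ
  set u : Fin n → ℝ := fun j => M j.castSucc - M j.succ with hu
  -- This is the capacity left after the source has sent every packet once.
  set c : Fin (k + 1) → ℝ := fun v => C v - if v = 0 then ∑ j, L j else 0 with hc
  have zero_mem : ∀ i, (0 : Fin (k + 1)) ∈ X i := fun i =>
    hX (Fin.le_last i) (by rw [hX_last]; exact Finset.mem_singleton_self 0)
  have hμ0 : ∀ j, 0 ≤ μ j := by
    intro j
    obtain ⟨v, hv, hv0⟩ := hX_peer j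
    refine sub_nonneg.2 ?_
    exact_mod_cast Finset.card_pos.2 ⟨v, Finset.mem_erase.2 ⟨hv0, hv⟩⟩
  have hcount : ∀ j, (peerCount (X j.castSucc) : ℝ) = μ j + 1 := fun j => by simp [hμ]
  have hc0 : ∀ v, 0 ≤ c v := by
    intro v
    simp only [hc]
    split_ifs with h
    · rw [h]; linarith
    · linarith [hC v]
  have hcsum : ∀ A : Finset (Fin (k + 1)), 0 ∈ A → ∑ v ∈ A, c v = ∑ v ∈ A, C v - ∑ j, L j := by
    intro A hA
    rw [hc, Finset.sum_sub_distrib, Finset.sum_ite_eq', if_pos hA]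
  have hMlast : M (Fin.last n) = 0 := by rw [hM, tailMax_last, margin_last]
  have hmargin : ∀ j : Fin n, margin X C L j.castSucc
      = ∑ i, (if j ≤ i then μ i * L i else 0) - ∑ v ∈ X j.castSucc, c v := by
    intro j
    rw [margin_castSucc, hcsum _ (zero_mem _), ← sub_add, sub_add_eq_add_sub,
      ← Finset.sum_add_distrib]
    congr 1
    refine Finset.sum_congr rfl fun i _ => ?_
    rw [hcount]
    split_ifs <;> ring
  have hu0 : ∀ j, 0 ≤ u j := fun j =>
    sub_nonneg.2 (tailMax_antitone _ j.castSucc_lt_succ.le)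
  -- Spare capacity only shrinks from `X_j` to the next set, so the margin, and with it the running
  -- maximum, drops by at most `μ j * L j`.
  have huL : ∀ j, u j ≤ μ j * L j := by
    intro j
    have hnn := mul_nonneg (hμ0 j) (hL j)
    have h1 : margin X C L j.castSucc - margin X C L j.succ ≤ μ j * L j := by
      have hsub : ∑ v ∈ X j.succ, c v ≤ ∑ v ∈ X j.castSucc, c v :=
        Finset.sum_le_sum_of_subset_of_nonneg (hX j.castSucc_lt_succ.le) fun v _ _ => hc0 v
      have hge : ∑ i : Fin n, (if j.succ ≤ i.castSucc then μ i * L i else 0)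
          - ∑ v ∈ X j.succ, c v ≤ margin X C L j.succ := by
        generalize j.succ = l
        induction l using Fin.lastCases with
        | last =>
          rw [margin_last, hX_last, Finset.sum_singleton, Finset.sum_eq_zero fun i _ =>
            if_neg (not_le.2 (Fin.castSucc_lt_last i))]
          linarith [hc0 0]
        | cast l =>
          rw [hmargin]
          simp only [Fin.castSucc_le_castSucc_iff]
          exact le_rfl
      have hsplit : ∑ i, (if j ≤ i then μ i * L i else 0)
          = ∑ i : Fin n, (if j.succ ≤ i.castSucc then μ i * L i else 0) + μ j * L j := by
        have : ∀ i, (if j ≤ i then μ i * L i else 0)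
            = (if j.succ ≤ i.castSucc then μ i * L i else 0)
              + if i = j then μ j * L j else 0 := by
          intro i
          simp only [Fin.succ_le_castSucc_iff]
          rcases lt_trichotomy j i with h | h | h
          · simp [h, h.le, h.ne']
          · simp [h]
          · simp [h.not_gt, h.not_ge, h.ne]
        rw [Finset.sum_congr rfl fun i _ => this i, Finset.sum_add_distrib]
        simp
      rw [hmargin, hsplit]
      linarith
    have h2 : margin X C L j.succ ≤ M j.succ := le_tailMax _ le_rfl
    simp only [hu]
    rw [hM, tailMax_castSucc, ← hM, sub_le_iff_le_add]
    exact max_le (by linarith) (by linarith)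
  -- Relaying inside `X_j`: the tail sums of `u` telescope to `M j`, which is at least the margin,
  -- so the cut condition holds.
  obtain ⟨y, hy0, hyX, hyR, hyc⟩ := exists_nested_transport (X := fun j : Fin n => X j.castSucc)
    (fun i j hij => hX (Fin.castSucc_le_castSucc_iff.2 hij)) (R := fun j => μ j * L j - u j)
    (fun j => sub_nonneg.2 (huL j)) hc0 (fun j => by
      have h1 := sum_tail_sub M j
      have h2 : margin X C L j.castSucc ≤ M j.castSucc := le_tailMax _ le_rfl
      rw [hmargin] at h2
      have h3 : ∑ i, (if j ≤ i then μ i * L i - u i else 0)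
          = ∑ i, (if j ≤ i then μ i * L i else 0) - ∑ i, (if j ≤ i then u i else 0) := by
        rw [← Finset.sum_sub_distrib]
        exact Finset.sum_congr rfl fun i _ => by split_ifs <;> ring
      rw [h3]
      simp only [hu]
      linarith)
  have hudiv : ∀ j, 0 ≤ u j / μ j := fun j => div_nonneg (hu0 j) (hμ0 j)
  -- The remaining load may go to any node and is charged at the outsider's cost, `(μ j + 1) / μ j`
  -- per unit; only total capacity matters.
  obtain ⟨y', hy0', -, hyR', hyc'⟩ := exists_nested_transport
    (X := fun _ : Fin n => (Finset.univ : Finset (Fin (k + 1)))) antitone_const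
    (R := fun j => u j + u j / μ j) (c := fun v => c v - ∑ j, y j v)
    (fun j => add_nonneg (hu0 j) (hudiv j)) (fun v => sub_nonneg.2 (hyc v)) (fun j => by
      have h1 : ∑ i, (if j ≤ i then u i + u i / μ i else 0) ≤ ∑ i, (u i + u i / μ i) :=
        Finset.sum_le_sum fun i _ => by
          split_ifs
          · exact le_rfl
          · exact add_nonneg (hu0 i) (hudiv i)
      refine h1.trans ?_
      rw [Finset.sum_sub_distrib, Finset.sum_comm, Finset.sum_congr rfl fun j _ => hyR j,
        hcsum _ (Finset.mem_univ 0), Finset.sum_sub_distrib, Finset.sum_add_distrib]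
      have h2 : ∑ j : Fin n, (peerCount (X j.castSucc) : ℝ) * L j
          = ∑ j, μ j * L j + ∑ j, L j := by
        rw [← Finset.sum_add_distrib]
        exact Finset.sum_congr rfl fun j _ => by rw [hcount]; ring
      rw [h2] at htotal
      linarith)
  -- Dividing by the number of copies turns upload into packet rate. If a single peer demands the
  -- layer, the source delivers it directly, at no cost beyond the reserved capacity.
  refine ⟨fun j v => if μ j = 0 then (if v = 0 then L j else 0)
    else y j v / μ j + y' j v / (μ j + 1), ?_, ?_, ?_⟩
  · intro j v
    have := hy0 j v
    have := hy0' j v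
    have := hμ0 j
    have := hL j
    dsimp only
    split_ifs <;> positivity
  · intro j
    by_cases hj : μ j = 0
    · simp [hj]
    · simp only [if_neg hj]
      rw [Finset.sum_add_distrib, ← Finset.sum_div, ← Finset.sum_div, hyR, hyR']
      have : μ j + 1 ≠ 0 := by linarith [hμ0 j, (hμ0 j).lt_of_ne' hj]
      field_simp
      ring
  · intro v
    have h1 := hyc' v
    have h2 : ∀ j : Fin n, ((peerCount (X j.castSucc) : ℝ) - if v ∈ X j.castSucc then 1 else 0)
        * (if μ j = 0 then (if v = 0 then L j else 0) else y j v / μ j + y' j v / (μ j + 1))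
        ≤ y j v + y' j v := by
      intro j
      have := hy0 j v
      have := hy0' j v
      rw [hcount]
      by_cases hj : μ j = 0
      · rw [if_pos hj]
        by_cases hv : v = 0
        · rw [if_pos (hv ▸ zero_mem _), hj]
          linarith
        · rw [if_neg hv]
          linarith
      · rw [if_neg hj]
        have hpos := (hμ0 j).lt_of_ne' hj
        by_cases hv : v ∈ X j.castSucc
        · rw [if_pos hv]
          have h3 : μ j * (y' j v / (μ j + 1)) ≤ y' j v := by
            rw [mul_div_assoc', div_le_iff₀ (by linarith)]
            nlinarith
          have h4 : μ j * (y j v / μ j) = y j v := by field_simp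
          linarith
        · rw [if_neg hv, hyX j v hv]
          have h5 : (μ j + 1) * (y' j v / (μ j + 1)) = y' j v := by
            field_simp
          rw [zero_div, zero_add, sub_zero, h5, zero_add]
    have h3 := Finset.sum_le_sum fun j (_ : j ∈ Finset.univ) => h2 j
    rw [Finset.sum_add_distrib] at h3
    simp only [hc] at h1
    linarith

end Rates

/-- Every number between `0` and `log (N + 1)` is the entropy of a distribution on `N + 1` points. -/
theorem exists_distribution (N : ℕ) {e : ℝ} (he : 0 ≤ e) (heN : e ≤ Real.log (N + 1)) :
    ∃ p : Fin (N + 1) → ℝ, (∀ a, 0 ≤ p a) ∧ ∑ a, p a = 1 ∧ ∑ a, Real.negMulLog (p a) = e := by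
  have hN : (0 : ℝ) < N + 1 := by positivity
  -- Along the segment from a point mass to the uniform distribution, entropy runs continuously from
  -- `0` to `log (N + 1)`.
  set q : ℝ → Fin (N + 1) → ℝ := fun s a => (1 - s) * (if a = 0 then 1 else 0) + s * (1 / (N + 1))
    with hq
  have hcont : Continuous fun s => ∑ a, Real.negMulLog (q s a) := by
    refine continuous_finsetSum _ fun a _ => Real.continuous_negMulLog.comp ?_
    simp only [hq]
    fun_prop
  have h0 : ∑ a, Real.negMulLog (q 0 a) = 0 := by
    refine Finset.sum_eq_zero fun a _ => ?_
    simp only [hq]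
    split_ifs <;> simp
  have h1 : ∑ a, Real.negMulLog (q 1 a) = Real.log (N + 1) := by
    simp only [hq, sub_self, zero_mul, zero_add, one_mul, Finset.sum_const, Finset.card_univ,
      Fintype.card_fin, nsmul_eq_mul, Real.negMulLog, one_div, Real.log_inv]
    push_cast
    field_simp
  obtain ⟨s, hs, hse⟩ := intermediate_value_Icc (zero_le_one' ℝ) hcont.continuousOn
    (show e ∈ Set.Icc _ _ from by
      simp only [h0, h1]
      exact ⟨he, heN⟩)
  refine ⟨q s, fun a => ?_, ?_, hse⟩
  · have := sub_nonneg.2 hs.2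
    have := hs.1
    simp only [hq]
    split_ifs <;> positivity
  · simp only [hq]
    rw [Finset.sum_add_distrib, ← Finset.mul_sum, Finset.sum_ite_eq' Finset.univ (0 : Fin (N + 1))]
    simp only [Finset.mem_univ, if_true, Finset.sum_const, Finset.card_univ,
      Fintype.card_fin, nsmul_eq_mul]
    push_cast
    field_simp
    ring

/-! ### Independent packets as coordinates of a product space -/

section Events

variable {Ω : Type} [Fintype Ω]

theorem prob_true (P : Ω → ℝ) {E : Ω → Prop} (hE : ∀ ω, E ω) :
    prob P E = ∑ ω, P ω := by
  classical
  unfold prob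
  rw [Finset.filter_true_of_mem fun ω _ => hE ω]

theorem prob_false (P : Ω → ℝ) {E : Ω → Prop} (hE : ∀ ω, ¬ E ω) :
    prob P E = 0 := by
  classical
  unfold prob
  rw [Finset.filter_false_of_mem fun ω _ => hE ω, Finset.sum_empty]

theorem prob_eq_value (P : Ω → ℝ) (a : Ω) :
    prob P (fun ω => ω = a) = P a := by
  classical
  unfold prob
  rw [Finset.filter_eq' Finset.univ a, if_pos (Finset.mem_univ a), Finset.sum_singleton]

end Events

section RestrictCoords

variable {Q A : Type} [Inhabited A]

open Classical in
/-- The coordinates in `S`; the other coordinates are overwritten by a fixed value. -/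
noncomputable def restrictCoords (S : Set Q) (ω : Q → A) : Q → A :=
  fun q => if q ∈ S then ω q else default

theorem restrictCoords_eq_iff {S : Set Q} {ω ω' : Q → A} :
    restrictCoords S ω = restrictCoords S ω' ↔ ∀ q ∈ S, ω q = ω' q := by
  simp only [restrictCoords, funext_iff]
  refine forall_congr' fun q => ?_
  by_cases h : q ∈ S <;> simp [h]

theorem sameInfo_restrictCoords (S : Set Q) :
    SameInfo (restrictCoords S) (fun (ω : Q → A) (q : {q : Q // q ∈ S}) => ω q.1) := by
  intro ω ω'
  rw [restrictCoords_eq_iff]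
  simp [funext_iff]

end RestrictCoords

section ProductMeasure

variable {Q A : Type} [Fintype Q]

/-- The weights of a product distribution. -/
noncomputable def productWeight (p : Q → A → ℝ) (ω : Q → A) : ℝ := ∏ q, p q (ω q)

variable {p : Q → A → ℝ}

theorem productWeight_nonneg (hp : ∀ q a, 0 ≤ p q a) (ω : Q → A) : 0 ≤ productWeight p ω :=
  Finset.prod_nonneg fun q _ => hp q (ω q)

variable [DecidableEq Q] [Fintype A]

theorem prob_cylinder (E : Q → A → Prop) :
    prob (productWeight p) (fun ω => ∀ q, E q (ω q)) = ∏ q, prob (p q) (E q) := by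
  classical
  unfold prob productWeight
  rw [Finset.prod_univ_sum]
  refine Finset.sum_congr ?_ fun _ _ => rfl
  ext ω
  simp [Fintype.mem_piFinset]

theorem sum_productWeight (hp1 : ∀ q, ∑ a, p q a = 1) : ∑ ω, productWeight p ω = 1 := by
  rw [← prob_true (productWeight p) (E := fun ω => ∀ q : Q, (fun _ _ => True) q (ω q))
    (fun _ _ => trivial), prob_cylinder (E := fun _ _ => True)]
  exact Finset.prod_eq_one fun q _ => by rw [prob_true _ fun _ => trivial, hp1]

theorem prob_coordinate (hp1 : ∀ q, ∑ a, p q a = 1) (q : Q) (a : A) :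
    prob (productWeight p) (fun ω => ω q = a) = p q a := by
  rw [prob_congr (B := fun ω => ∀ q', (fun q' x => q' = q → x = a) q' (ω q')) (by simp),
    prob_cylinder (E := fun q' x => q' = q → x = a), Finset.prod_eq_single q]
  · rw [prob_congr (B := fun x => x = a) (by simp), prob_eq_value]
  · intro q' _ hq'
    rw [prob_true _ fun x h => absurd h hq', hp1]
  · simp

theorem independent_coordinates (hp1 : ∀ q, ∑ a, p q a = 1) :
    Independent (productWeight p) (fun q (ω : Q → A) => ω q) := by
  intro a
  rw [prob_cylinder (E := fun q x => x = a q)]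
  exact Finset.prod_congr rfl fun q _ => by rw [prob_coordinate hp1, prob_eq_value]

theorem entropy_coordinate (hp1 : ∀ q, ∑ a, p q a = 1) (q : Q) :
    entropy (productWeight p) (fun ω : Q → A => ω q) = ∑ a, Real.negMulLog (p q a) := by
  classical
  unfold entropy
  simp only [prob_coordinate hp1]
  refine Finset.sum_subset (Finset.subset_univ _) fun a _ ha => ?_
  rw [← prob_coordinate hp1 q a, prob_false, Real.negMulLog_zero]
  rintro ω rfl
  exact ha (Finset.mem_image_of_mem _ (Finset.mem_univ ω))

/-- Disjoint blocks of coordinates are independent. -/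
theorem independent_blocks [Inhabited A] {J : Type} [Fintype J] (hp1 : ∀ q, ∑ a, p q a = 1) (f : Q → J) :
    Independent (productWeight p) (fun j => restrictCoords (A := A) {q | f q = j}) := by
  classical
  intro a
  set E : J → Q → A → Prop := fun j q x => (if f q = j then x else default) = a j q with hE
  have h1 : ∀ j (ω : Q → A), restrictCoords {q | f q = j} ω = a j ↔ ∀ q, E j q (ω q) := by
    intro j ω
    simp only [restrictCoords, funext_iff, hE, Set.mem_ofPred_eq]
  rw [prob_congr (B := fun ω => ∀ q, (fun q x => ∀ j, E j q x) q (ω q)) (fun ω => by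
      simp only [h1]; exact forall_comm), prob_cylinder (E := fun q x => ∀ j, E j q x)]
  simp only [fun j => prob_congr (P := productWeight p) (h1 j), prob_cylinder]
  rw [Finset.prod_comm]
  refine Finset.prod_congr rfl fun q _ => ?_
  -- A prescribed value that differs from `default` outside its block is impossible, and then both
  -- factors vanish.
  by_cases hdef : ∀ j, f q ≠ j → default = a j q
  · rw [Finset.prod_eq_single (f q)]
    · refine prob_congr fun x => ⟨fun h => h (f q), fun h j => ?_⟩
      by_cases hj : f q = j
      · exact hj ▸ h
      · simp only [hE, if_neg hj]
        exact hdef j hj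
    · intro j _ hj
      rw [prob_true _ fun x => ?_, hp1]
      simp only [hE, if_neg hj.symm]
      exact hdef j hj.symm
    · simp
  · push Not at hdef
    obtain ⟨j, hj, hne⟩ := hdef
    have hfalse : ∀ x, ¬ E j q x := fun x h => by
      simp only [hE, if_neg hj] at h
      exact hne h
    rw [prob_false _ fun x h => hfalse x (h j)]
    exact (Finset.prod_eq_zero (Finset.mem_univ j) (prob_false _ hfalse)).symm

theorem entropy_of_coordinates (hp : ∀ q a, 0 ≤ p q a) (hp1 : ∀ q, ∑ a, p q a = 1)
    {β : Type} {Y : (Q → A) → β} (S : Finset Q)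
    (hY : ∀ ω ω', Y ω = Y ω' ↔ ∀ q ∈ S, ω q = ω' q) :
    entropy (productWeight p) Y = ∑ q ∈ S, ∑ a, Real.negMulLog (p q a) := by
  rw [entropy_eq_jointEntropy (Y := fun q ω => ω q) (A := (S : Set Q)) (by simpa using hY),
    jointEntropy_of_independent (productWeight_nonneg hp) (sum_productWeight hp1)
      (independent_coordinates hp1)]
  exact Finset.sum_congr rfl fun q _ => entropy_coordinate hp1 q

end ProductMeasure

theorem condEntropy_eq_zero {Ω α β : Type} [Fintype Ω] {P : Ω → ℝ} {X : Ω → α} {Y : Ω → β}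
    (h : ∀ ω ω', Y ω = Y ω' → X ω = X ω') : condEntropy P X Y = 0 := by
  rw [condEntropy, sub_eq_zero]
  exact entropy_congr fun ω ω' => by
    rw [Prod.mk.injEq]
    exact ⟨And.right, fun hY => ⟨h ω ω' hY, hY⟩⟩

theorem mutualInfo_eq_entropy {Ω α β : Type} [Fintype Ω] {P : Ω → ℝ} {X : Ω → α} {Y : Ω → β}
    (h : ∀ ω ω', X ω = X ω' → Y ω = Y ω') : mutualInfo P X Y = entropy P Y := by
  have : entropy P (fun ω => (X ω, Y ω)) = entropy P X := entropy_congr fun ω ω' => by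
    rw [Prod.mk.injEq]
    exact ⟨And.left, fun hX => ⟨hX, h ω ω' hX⟩⟩
  rw [mutualInfo, this]
  ring

/-! ### The two-round routing scheme -/

section Relay

variable {k n : ℕ}

/-- In round `0` the source sends the packet `(j, v)` to the relay `v`, and the packet `(j, 0)` to
all peers that demand layer `j`; in round `1` every peer relays its packets to the other peers that
demand them. -/
def relaySend (X : Fin (n + 1) → Finset (Fin (k + 1))) (t : Fin 2) (u w : Fin (k + 1)) :
    Set (Fin n × Fin (k + 1)) :=
  {q | w ≠ 0 ∧ ((t = 0 ∧ u = 0 ∧ (q.2 = w ∨ q.2 = 0 ∧ w ∈ X q.1.castSucc)) ∨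
    (t = 1 ∧ u ≠ 0 ∧ q.2 = u ∧ w ≠ u ∧ w ∈ X q.1.castSucc))}

theorem relaySend_causal {X : Fin (n + 1) → Finset (Fin (k + 1))} (t : Fin 2) (u v : Fin (k + 1))
    (hu : u ≠ 0) : ∀ q ∈ relaySend X t u v, ∃ s < t, ∃ w, q ∈ relaySend X s w u := by
  rintro q ⟨-, ⟨-, h, -⟩ | ⟨rfl, -, rfl, -, -⟩⟩
  · exact absurd h hu
  · exact ⟨0, by decide, 0, hu, Or.inl ⟨rfl, rfl, Or.inl rfl⟩⟩

open Classical in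
/-- The packets that are sent from `u` to `w`. -/
noncomputable def relayLink (X : Fin (n + 1) → Finset (Fin (k + 1))) (u w : Fin (k + 1)) :
    Finset (Fin n × Fin (k + 1)) :=
  Finset.univ.filter fun q => ∃ t, q ∈ relaySend X t u w

theorem mem_relayLink {X : Fin (n + 1) → Finset (Fin (k + 1))} {u w : Fin (k + 1)}
    {q : Fin n × Fin (k + 1)} : q ∈ relayLink X u w ↔ w ≠ 0 ∧
      ((u = 0 ∧ (q.2 = w ∨ q.2 = 0 ∧ w ∈ X q.1.castSucc)) ∨
        (u ≠ 0 ∧ q.2 = u ∧ w ≠ u ∧ w ∈ X q.1.castSucc)) := by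
  simp only [relayLink, relaySend, Finset.mem_filter, Finset.mem_univ, true_and,
    Set.mem_ofPred_eq, Fin.exists_fin_two]
  grind

variable {X : Fin (n + 1) → Finset (Fin (k + 1))} {r : Fin n → Fin (k + 1) → ℝ}

theorem sum_relayLink (u : Fin (k + 1)) :
    ∑ w, ∑ q ∈ relayLink X u w, r q.1 q.2
      = ∑ j, ∑ v, ((Finset.univ.filter fun w => (j, v) ∈ relayLink X u w).card : ℝ) * r j v := by
  classical
  have h1 : ∀ w, ∑ q ∈ relayLink X u w, r q.1 q.2
      = ∑ q, if q ∈ relayLink X u w then r q.1 q.2 else 0 := fun w => by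
    rw [Finset.sum_ite_mem, Finset.univ_inter]
  rw [Finset.sum_congr rfl fun w _ => h1 w, Finset.sum_comm, Fintype.sum_prod_type]
  refine Finset.sum_congr rfl fun j _ => Finset.sum_congr rfl fun v _ => ?_
  rw [← Finset.sum_filter, Finset.sum_const, nsmul_eq_mul]

/-- Each packet is sent once to its relay, except that `(j, 0)` goes to all peers demanding `j`,
which makes `|X_j| - 1` copies beyond the first. -/
theorem sum_relayLink_source (h0 : ∀ i, (0 : Fin (k + 1)) ∈ X i) :
    ∑ w, ∑ q ∈ relayLink X 0 w, r q.1 q.2 = ∑ j : Fin n, ∑ v, r j v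
      + ∑ j : Fin n, ((peerCount (X j.castSucc) : ℝ) - if 0 ∈ X j.castSucc then 1 else 0) * r j 0 := by
  rw [sum_relayLink, ← Finset.sum_add_distrib]
  refine Finset.sum_congr rfl fun j _ => ?_
  rw [if_pos (h0 _)]
  have h1 : ∀ v, ((Finset.univ.filter fun w => (j, v) ∈ relayLink X 0 w).card : ℝ) * r j v
      = r j v + if v = 0 then ((peerCount (X j.castSucc) : ℝ) - 1) * r j 0 else 0 := by
    intro v
    by_cases hv : v = 0
    · have : (Finset.univ.filter fun w => (j, v) ∈ relayLink X 0 w) = (X j.castSucc).erase 0 := by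
        ext w
        simp only [mem_relayLink, Finset.mem_filter, Finset.mem_univ, true_and, Finset.mem_erase,
          hv]
        grind
      rw [this, if_pos hv, peerCount, hv]
      ring
    · have : (Finset.univ.filter fun w => (j, v) ∈ relayLink X 0 w) = {v} := by
        ext w
        simp only [mem_relayLink, Finset.mem_filter, Finset.mem_univ, true_and,
          Finset.mem_singleton]
        grind
      rw [this, if_neg hv]
      simp
  rw [Finset.sum_congr rfl fun v _ => h1 v, Finset.sum_add_distrib,
    Finset.sum_ite_eq' Finset.univ (0 : Fin (k + 1)), if_pos (Finset.mem_univ _)]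

theorem sum_relayLink_peer {u : Fin (k + 1)} (hu : u ≠ 0) :
    ∑ w, ∑ q ∈ relayLink X u w, r q.1 q.2
      = ∑ j : Fin n, ((peerCount (X j.castSucc) : ℝ) - if u ∈ X j.castSucc then 1 else 0) * r j u := by
  rw [sum_relayLink]
  refine Finset.sum_congr rfl fun j _ => ?_
  rw [Finset.sum_eq_single u]
  · congr 1
    have : (Finset.univ.filter fun w => (j, u) ∈ relayLink X u w)
        = ((X j.castSucc).erase 0).erase u := by
      ext w
      simp only [mem_relayLink, Finset.mem_filter, Finset.mem_univ, true_and, Finset.mem_erase]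
      grind
    rw [this, peerCount]
    split_ifs with h
    · rw [Finset.cast_card_erase_of_mem (Finset.mem_erase.2 ⟨hu, h⟩)]
    · rw [Finset.erase_eq_of_notMem fun h' => h (Finset.mem_of_mem_erase h'), sub_zero]
  · intro v _ hv
    have : (Finset.univ.filter fun w => (j, v) ∈ relayLink X u w) = ∅ := by
      ext w
      simp only [mem_relayLink, Finset.mem_filter, Finset.mem_univ, true_and]
      grind
    simp [this]
  · simp

theorem achievableByRouting_of_rates {C : Fin (k + 1) → ℝ} {L : Fin n → ℝ}
    (h0 : ∀ i, (0 : Fin (k + 1)) ∈ X i) (hr : ∀ j v, 0 ≤ r j v) (hrL : ∀ j, ∑ v, r j v = L j)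
    (hrC : ∀ v, ∑ j : Fin n,
      ((peerCount (X j.castSucc) : ℝ) - if v ∈ X j.castSucc then 1 else 0) * r j v
        ≤ C v - if v = 0 then ∑ j, L j else 0) :
    AchievableByRouting X C L := by
  classical
  obtain ⟨N, hN⟩ : ∃ N : ℕ, ∀ q : Fin n × Fin (k + 1), r q.1 q.2 ≤ Real.log (N + 1) := by
    obtain ⟨N, hN⟩ := exists_nat_ge (∑ q : Fin n × Fin (k + 1), Real.exp (r q.1 q.2))
    refine ⟨N, fun q => ?_⟩
    rw [Real.le_log_iff_exp_le (by positivity)]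
    have := Finset.single_le_sum (f := fun q : Fin n × Fin (k + 1) => Real.exp (r q.1 q.2))
      (fun q _ => (Real.exp_pos _).le) (Finset.mem_univ q)
    linarith
  choose p hp hp1 hpr using fun q : Fin n × Fin (k + 1) => exists_distribution N (hr q.1 q.2) (hN q)
  let S : Scheme k n :=
    { Ω := Fin n × Fin (k + 1) → Fin (N + 1)
      P := productWeight p
      P_nonneg := productWeight_nonneg hp
      P_sum := sum_productWeight hp1
      Data := Fin n × Fin (k + 1) → Fin (N + 1)
      Msg := Fin n × Fin (k + 1) → Fin (N + 1)
      T := 2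
      x := fun j => restrictCoords {q | q.1 = j}
      msg := fun t u w => restrictCoords (relaySend X t u w) }
  have hx : ∀ j (ω ω' : Fin n × Fin (k + 1) → Fin (N + 1)),
      S.x j ω = S.x j ω' ↔ ∀ q : Fin n × Fin (k + 1), q.1 = j → ω q = ω' q :=
    fun j ω ω' => restrictCoords_eq_iff
  have hmsg : ∀ t u w (ω ω' : Fin n × Fin (k + 1) → Fin (N + 1)),
      S.msg t u w ω = S.msg t u w ω' ↔ ∀ q ∈ relaySend X t u w, ω q = ω' q :=
    fun t u w ω ω' => restrictCoords_eq_iff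
  have hlink : ∀ u w (ω ω' : Fin n × Fin (k + 1) → Fin (N + 1)),
      S.link u w ω = S.link u w ω' ↔ ∀ q ∈ relayLink X u w, ω q = ω' q := by
    intro u w ω ω'
    simp only [relayLink, Finset.mem_filter, Finset.mem_univ, true_and, forall_exists_index]
    exact funext_iff.trans ((forall_congr' fun t => hmsg t u w ω ω').trans
      ⟨fun h q t hq => h t q hq, fun h t q hq => h q t hq⟩)
  have hentropy : ∀ u w, entropy S.P (S.link u w) = ∑ q ∈ relayLink X u w, r q.1 q.2 := by
    intro u w
    exact (entropy_of_coordinates hp hp1 _ (hlink u w)).trans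
      (Finset.sum_congr rfl fun q _ => hpr q)
  refine ⟨S, ⟨independent_blocks hp1 Prod.fst, ?_, ?_, ?_, ?_, ?_, ?_⟩, ?_⟩
  · intro j
    refine (entropy_of_coordinates hp hp1 (Finset.univ.filter fun q => q.1 = j)
      (by simpa using hx j)).trans ?_
    rw [Finset.sum_congr rfl fun q _ => hpr q, Finset.sum_filter, Fintype.sum_prod_type,
      Finset.sum_eq_single j]
    · simpa using hrL j
    · intro i _ hi
      simp [hi]
    · simp
  · refine fun v => condEntropy_eq_zero fun ω ω' h => (hlink 0 v ω ω').2 fun q _ => ?_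
    exact (hx q.1 ω ω').1 (congrFun h q.1) q rfl
  · refine fun t u v hu => condEntropy_eq_zero fun ω ω' h => (hmsg t u v ω ω').2 fun q hq => ?_
    obtain ⟨s, hs, w, hw⟩ := relaySend_causal t u v hu q hq
    exact (hmsg s w u ω ω').1 (congrFun (congrFun h w) ⟨s, hs⟩) q hw
  · intro u
    rw [hentropy]
    refine Finset.sum_eq_zero fun q hq => ?_
    rw [mem_relayLink] at hq
    grind
  · intro u
    rw [Finset.sum_congr rfl fun w _ => hentropy u w]
    have := hrC u
    by_cases hu : u = 0
    · subst hu
      rw [sum_relayLink_source h0, Finset.sum_congr rfl fun j _ => hrL j]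
      rw [if_pos rfl] at this
      linarith
    · rw [sum_relayLink_peer hu]
      simpa [hu] using this
  · refine fun j i hi hi0 => mutualInfo_eq_entropy fun ω ω' h => (hx j ω ω').2 ?_
    rintro q rfl
    have hin : ∀ u, q ∈ relayLink X u i → ω q = ω' q := fun u hu =>
      (hlink u i ω ω').1 (congrFun h u) q hu
    -- The packet comes straight from the source if its relay is `i` or the source, and otherwise
    -- from its relay.
    by_cases hv : q.2 = i ∨ q.2 = 0
    · exact hin 0 (mem_relayLink.2 ⟨hi0, Or.inl ⟨rfl, hv.imp_right fun h => ⟨h, hi⟩⟩⟩)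
    · rw [not_or] at hv
      exact hin q.2 (mem_relayLink.2 ⟨hi0, Or.inr ⟨hv.2, rfl, Ne.symm hv.1, hi⟩⟩)
  · exact ⟨Fin n × Fin (k + 1), Fin (N + 1), inferInstance, Prod.fst, fun q ω => ω q,
      relaySend X, independent_coordinates hp1,
      fun j => sameInfo_restrictCoords (A := Fin (N + 1)) {q : Fin n × Fin (k + 1) | q.1 = j},
      fun t u v => sameInfo_restrictCoords (A := Fin (N + 1)) (relaySend X t u v),
      relaySend_causal⟩

end Relay

end P2P

theorem mainTheorem3 (k n : ℕ)
    (X : Fin (n + 1) → Finset (Fin (k + 1)))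
    (hX_anti : Antitone X)
    (hX_first : X 0 = Finset.univ)
    (hX_last : X (Fin.last n) = {0})
    (hX_peer : ∀ j : Fin n, ∃ i ∈ X j.castSucc, i ≠ 0)
    (C : Fin (k + 1) → ℝ) (hC : ∀ i, 0 ≤ C i)
    (L : Fin n → ℝ) (hL : ∀ j, 0 ≤ L j)
    (h : ℕ) (d : Fin (h + 1) → Fin (n + 1))
    (hd : P2P.IsDominantSubsequence (P2P.margin X C L) d) :
    (P2P.Achievable X C L ↔ P2P.InRegion X C L d) ∧
    (P2P.AchievableByRouting X C L ↔ P2P.InRegion X C L d) := by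
  have converse := P2P.inRegion_of_achievable hX_anti hX_first hX_last hX_peer hC hd
  have direct : P2P.InRegion X C L d → P2P.AchievableByRouting X C L := by
    rintro ⟨hsource, htotal⟩
    rw [hd.sum_eq_sum_tailMax (fun i => (P2P.peerCount (X i) : ℝ) - 1), hX_first] at htotal
    obtain ⟨r, hr, hrL, hrC⟩ :=
      P2P.exists_rates hX_anti hX_last hX_peer hC hL hsource htotal
    exact P2P.achievableByRouting_of_rates (fun i => hX_anti (Fin.le_last i)
      (by rw [hX_last]; exact Finset.mem_singleton_self 0)) hr hrL hrC
  have weaken : P2P.AchievableByRouting X C L → P2P.Achievable X C L :=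
    fun ⟨S, hS, _⟩ => ⟨S, hS⟩
  exact ⟨⟨converse, fun hR => weaken (direct hR)⟩, ⟨fun hA => converse (weaken hA), direct⟩⟩
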